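/- Let $0<q<1$. Let $\mathcal H$ be the Hilbert space with orthonormal basis $f^{(n)}_{x,y}$, $n\in\mathbb N=\{0,1,2,\dots\}$, $x,y\in\{0,\dots,n\}$ (in the usual notation $f^{(n)}_{x,y}=e^{(n/2)}_{x-n/2,\,y-n/2}$), and let $D$ be the self-adjoint diagonal operator with $Df^{(n)}_{x,y}=n\,f^{(n)}_{x,y}$ if $x=n$ and $Df^{(n)}_{x,y}=-n\,f^{(n)}_{x,y}$ otherwise. Let $\delta(T)=[|D|,T]$ be the associated unbounded derivation of the algebra of bounded operators on $\mathcal H$. Define bounded operators on $\mathcal H$ by $$\alpha_+f^{(n)}_{x,y}=q^{x+y+1}\frac{(1-q^{2(n-y)+2})^{1/2}(1-q^{2(n-x)+2})^{1/2}}{(1-q^{2n+2})^{1/2}(1-q^{2n+4})^{1/2}}\,f^{(n+1)}_{x,y},\qquad \alpha_-f^{(n)}_{x,y}=\frac{(1-q^{2y})^{1/2}(1-q^{2x})^{1/2}}{(1-q^{2n})^{1/2}(1-q^{2n+2})^{1/2}}\,f^{(n-1)}_{x-1,y-1},$$ $$\beta_+f^{(n)}_{x,y}=-q^{y}\frac{(1-q^{2(n-y)+2})^{1/2}(1-q^{2x+2})^{1/2}}{(1-q^{2n+2})^{1/2}(1-q^{2n+4})^{1/2}}\,f^{(n+1)}_{x+1,y},\qquad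 \beta_-f^{(n)}_{x,y}=q^{x}\frac{(1-q^{2y})^{1/2}(1-q^{2(n-x)})^{1/2}}{(1-q^{2n})^{1/2}(1-q^{2n+2})^{1/2}}\,f^{(n-1)}_{x,y-1},$$ where $\alpha_-f^{(n)}_{x,y}=0$ if $x=0$ or $y=0$, and $\beta_-f^{(n)}_{x,y}=0$ if $y=0$ or $x=n$. Put $\alpha=\alpha_++\alpha_-$ and $\beta=\beta_++\beta_-$ (the standard representation of $SU_q(2)$), let $\mathcal A$ be the unital $*$-algebra generated by $\alpha,\beta$, and let $\mathcal B$ be the algebra generated by all $\delta^k(a)$, $a\in\mathcal A$, $k\in\mathbb N$; it contains $\alpha_\pm$ and $\beta_\pm$. Let $C^\infty(D^2_{q+})$ and $C^\infty(D^2_{q-})$ both be the smooth Toeplitz algebra, that is, the $*$-algebra of all operators $T_f+R$ on $\ell^2(\mathbb N)$ (with basis $\varepsilon_x$), where $T_f$ is the Toeplitz operator with symbol $f\in C^\infty(S^1)$ and $R$ a matrix of rapid decay. In $C^\infty(D^2_{q\pm})$ let $\alpha$ and $\beta$ denote the elements $\alpha\,\varepsilon_x=(1-q^{2x})^{1/2}\varepsilon_{x-1}$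 (with $\alpha\,\varepsilon_0=0$) and $\beta\,\varepsilon_x=\pm q^x\varepsilon_x$, and let $u=e^{i\theta}$ be the generator of $C^\infty(S^1)$. Then there is exactly one unital $*$-homomorphism $$\rho:\mathcal B\to C^\infty(D^2_{q+})\otimes C^\infty(D^2_{q-})\otimes C^\infty(S^1)$$ (algebraic tensor product over $\mathbb C$) such that $$\rho(\alpha_+)=-q\,\beta^*\otimes\beta\otimes u,\quad \rho(\alpha_-)=\alpha\otimes\alpha\otimes u^*,\quad \rho(\beta_+)=\alpha^*\otimes\beta\otimes u,\quad \rho(\beta_-)=\beta\otimes\alpha\otimes u^*.$$ -/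

import Mathlib

open scoped TensorProduct ContDiff

noncomputable section

namespace SUq2

/-! ### Hilbert spaces with a distinguished basis and weighted partial shifts -/

/-- The Hilbert space `ℓ²(ι)`. -/
abbrev Ell2 (ι : Type) : Type := lp (fun _ : ι => ℂ) 2

/-- The basis vector of `ℓ²(ι)` with index `i`. -/
def ket {ι : Type} (i : ι) : Ell2 ι :=
  letI := Classical.decEq ι
  lp.single 2 i 1

/-- An injective map, seen as a partial bijection. -/
def ofInjective {ι κ : Type} (g : ι → κ) (hg : Function.Injective g) : ι ≃. κ where
  toFun i := some (g i)
  invFun := Function.partialInv g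
  inv a b := by
    rw [hg.isPartialInv a b, Option.some.injEq]

theorem weightedShift_aux {ι κ : Type} (e : ι ≃. κ) (c : ι → ℂ) (hc : ∀ i, ‖c i‖ ≤ 1)
    (ξ : Ell2 ι) (s : Finset κ) :
    ∑ j ∈ s, ‖(e.symm j).elim 0 (fun i => c i * ξ i)‖ ^ (2 : ENNReal).toReal
      ≤ ‖ξ‖ ^ (2 : ENNReal).toReal := by
  classical
  have h2 : (0 : ℝ) < (2 : ENNReal).toReal := by norm_num
  let t : Finset ι := s.biUnion fun j => (e.symm j).toFinset
  refine le_trans ?_ (lp.sum_rpow_le_norm_rpow h2 ξ t)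
  have hdis : Set.PairwiseDisjoint (s : Set κ) fun j => (e.symm j).toFinset := by
    intro j _ j' _ hjj'
    refine Finset.disjoint_left.2 fun i hi hi' => hjj' ?_
    rw [Option.mem_toFinset] at hi hi'
    exact e.symm.inj hi hi'
  rw [Finset.sum_biUnion hdis]
  refine Finset.sum_le_sum fun j _ => ?_
  cases h : e.symm j with
  | none => simp
  | some i =>
    simp only [Option.elim, Option.toFinset_some, Finset.sum_singleton]
    refine Real.rpow_le_rpow (norm_nonneg _) ?_ h2.le
    rw [norm_mul]
    exact mul_le_of_le_one_left (norm_nonneg _) (hc i)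

/-- The bounded operator `ℓ²(ι) → ℓ²(κ)` which sends the basis vector of index `i` to `c i` times
the basis vector of index `e i`, and to `0` where `e` is not defined; see `weightedShift_ket`. -/
def weightedShift {ι κ : Type} (e : ι ≃. κ) (c : ι → ℂ) (hc : ∀ i, ‖c i‖ ≤ 1) :
    Ell2 ι →L[ℂ] Ell2 κ :=
  LinearMap.mkContinuous
    { toFun := fun ξ => ⟨fun j => (e.symm j).elim 0 (fun i => c i * ξ i),
        memℓp_gen' (weightedShift_aux e c hc ξ)⟩
      map_add' := fun ξ η => by
        ext j
        change (e.symm j).elim 0 (fun i => c i * (ξ i + η i)) =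
          (e.symm j).elim 0 (fun i => c i * ξ i) + (e.symm j).elim 0 (fun i => c i * η i)
        cases e.symm j with
        | none => simp
        | some i => simp [mul_add]
      map_smul' := fun z ξ => by
        ext j
        change (e.symm j).elim 0 (fun i => c i * (z * ξ i)) =
          z * (e.symm j).elim 0 (fun i => c i * ξ i)
        cases e.symm j with
        | none => simp
        | some i => simp [mul_left_comm] }
    1 fun ξ => by
      rw [one_mul]
      exact lp.norm_le_of_forall_sum_le (by norm_num) (norm_nonneg _)
        (weightedShift_aux e c hc ξ)

theorem weightedShift_apply {ι κ : Type} (e : ι ≃. κ) (c : ι → ℂ) (hc : ∀ i, ‖c i‖ ≤ 1)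
    (ξ : Ell2 ι) (j : κ) :
    weightedShift e c hc ξ j = (e.symm j).elim 0 (fun i => c i * ξ i) := rfl

theorem ket_apply {ι : Type} [DecidableEq ι] (i j : ι) :
    (ket i : Ell2 ι) j = if j = i then 1 else 0 := by
  by_cases h : j = i
  · subst h
    rw [if_pos rfl]
    exact @lp.single_apply_self _ _ _ (Classical.decEq ι) 2 j 1
  · rw [if_neg h]
    exact @lp.single_apply_ne _ _ _ (Classical.decEq ι) 2 i 1 j h

theorem weightedShift_ket {ι κ : Type} (e : ι ≃. κ) (c : ι → ℂ) (hc : ∀ i, ‖c i‖ ≤ 1) (i : ι) :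
    weightedShift e c hc (ket i) = (e i).elim 0 (fun j => c i • ket j) := by
  classical
  ext j
  rw [weightedShift_apply]
  cases h : e.symm j with
  | none =>
    cases h' : e i with
    | none => simp
    | some j' =>
      have hne : j ≠ j' := by
        rintro rfl
        rw [(e.eq_some_iff).2 h'] at h
        simp at h
      simp [ket_apply, hne]
  | some i' =>
    have h1 : e i' = some j := (e.eq_some_iff).1 h
    by_cases hi : i' = i
    · subst hi
      simp [h1, ket_apply]
    · cases h' : e i with
      | none => simp [ket_apply, hi]
      | some j' =>
        have hne : j ≠ j' := by
          rintro rfl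
          exact hi (e.inj h1 h')
        simp [ket_apply, hne, hi]

/-! ### The Hilbert space of the spectral triple and the derivation `δ` -/

/-- Index set of the orthonormal basis `e^{(n/2)}_{i,j}`, `n ∈ ℕ`, with the labels
`x = n/2 + i` and `y = n/2 + j`, which run through `{0, …, n}`. -/
@[ext]
structure Idx where
  n : ℕ
  x : ℕ
  y : ℕ
  hx : x ≤ n
  hy : y ≤ n

/-- The Hilbert space with orthonormal basis `e^{(n/2)}_{i,j}`. -/
abbrev Hil : Type := Ell2 Idx

/-- The eigenvalue `(2 δ₀(n/2 - i) - 1) n` of the diagonal operator `D` at `e^{(n/2)}_{i,j}`;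
`i = n/2` means `x = n`. -/
def diracEigenvalue (p : Idx) : ℝ := (2 * (if p.x = p.n then 1 else 0) - 1) * p.n

/-- `IsAbsD ξ η` means that `ξ` lies in the domain of the self-adjoint operator `|D|`, and
`η = |D| ξ`. -/
def IsAbsD (ξ η : Hil) : Prop := ∀ p : Idx, η p = (|diracEigenvalue p| : ℝ) * ξ p

/-- `IsDelta T S` means that the bounded operator `T` lies in the domain of the derivation
`δ = [|D|, ·]` and that `S = δ(T)`: `T` maps the domain of `|D|` to itself, and there
`|D| T ξ = T |D| ξ + S ξ`. -/
def IsDelta (T S : Hil →L[ℂ] Hil) : Prop :=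
  ∀ ξ η : Hil, IsAbsD ξ η → IsAbsD (T ξ) (T η + S ξ)

/-- `IsDeltaPow k T S` means that `T` lies in the domain of `δ ^ k` and `S = δ ^ k (T)`. -/
def IsDeltaPow : ℕ → (Hil →L[ℂ] Hil) → (Hil →L[ℂ] Hil) → Prop
  | 0, T, S => S = T
  | k + 1, T, S => ∃ R, IsDeltaPow k T R ∧ IsDelta R S

theorem abs_diracEigenvalue (p : Idx) : |diracEigenvalue p| = p.n := by
  unfold diracEigenvalue
  split_ifs <;> norm_num

/-! ### The coefficients of the representation -/

/-- `a_+(n/2, i, j)` in terms of `n`, `x = n/2 + i`, `y = n/2 + j`. -/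
def aPlus (q : ℝ) (n x y : ℕ) : ℝ :=
  q ^ (x + y + 1) * (√(1 - q ^ (2 * (n - y) + 2)) * √(1 - q ^ (2 * (n - x) + 2)) /
    (√(1 - q ^ (2 * n + 2)) * √(1 - q ^ (2 * n + 4))))

/-- `a_-(n/2, i, j)`; it vanishes for `x = 0` and for `y = 0`. -/
def aMinus (q : ℝ) (n x y : ℕ) : ℝ :=
  √(1 - q ^ (2 * y)) * √(1 - q ^ (2 * x)) / (√(1 - q ^ (2 * n)) * √(1 - q ^ (2 * n + 2)))

/-- `b_+(n/2, i, j)`. -/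
def bPlus (q : ℝ) (n x y : ℕ) : ℝ :=
  -q ^ y * (√(1 - q ^ (2 * (n - y) + 2)) * √(1 - q ^ (2 * x + 2)) /
    (√(1 - q ^ (2 * n + 2)) * √(1 - q ^ (2 * n + 4))))

/-- `b_-(n/2, i, j)`; it vanishes for `y = 0` and for `x = n`. -/
def bMinus (q : ℝ) (n x y : ℕ) : ℝ :=
  q ^ x * (√(1 - q ^ (2 * y)) * √(1 - q ^ (2 * (n - x))) /
    (√(1 - q ^ (2 * n)) * √(1 - q ^ (2 * n + 2))))

theorem sqrt_quot_le_one (q : Set.Ioo (0 : ℝ) 1) {a b c d : ℕ} (h1 : a ≤ c) (h2 : b ≤ d) :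
    √(1 - (q : ℝ) ^ a) * √(1 - (q : ℝ) ^ b) / (√(1 - (q : ℝ) ^ c) * √(1 - (q : ℝ) ^ d)) ≤ 1 := by
  have key : ∀ {m l : ℕ}, m ≤ l → √(1 - (q : ℝ) ^ m) ≤ √(1 - (q : ℝ) ^ l) := fun h =>
    Real.sqrt_le_sqrt (sub_le_sub_left (pow_le_pow_of_le_one q.2.1.le q.2.2.le h) 1)
  exact div_le_one_of_le₀ (mul_le_mul (key h1) (key h2) (Real.sqrt_nonneg _) (Real.sqrt_nonneg _))
    (by positivity)

theorem norm_coeff_le_one {s t : ℝ} (hs : |s| ≤ 1) (ht : 0 ≤ t) (ht' : t ≤ 1) :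
    ‖((s * t : ℝ) : ℂ)‖ ≤ 1 := by
  rw [Complex.norm_real, Real.norm_eq_abs, abs_mul, abs_of_nonneg ht]
  exact mul_le_one₀ hs ht ht'

theorem abs_pow_le_one (q : Set.Ioo (0 : ℝ) 1) (k : ℕ) : |(q : ℝ) ^ k| ≤ 1 := by
  rw [abs_of_nonneg (pow_nonneg q.2.1.le k)]
  exact pow_le_one₀ q.2.1.le q.2.2.le

theorem norm_aPlus_le (q : Set.Ioo (0 : ℝ) 1) (p : Idx) : ‖(aPlus q p.n p.x p.y : ℂ)‖ ≤ 1 :=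
  norm_coeff_le_one (abs_pow_le_one q _) (by positivity)
    (sqrt_quot_le_one q (by omega) (by omega))

theorem norm_aMinus_le (q : Set.Ioo (0 : ℝ) 1) (p : Idx) : ‖(aMinus q p.n p.x p.y : ℂ)‖ ≤ 1 := by
  have h := norm_coeff_le_one (s := 1) (by simp) (by positivity)
    (sqrt_quot_le_one q (a := 2 * p.y) (b := 2 * p.x) (c := 2 * p.n) (d := 2 * p.n + 2)
      (by have := p.hy; omega) (by have := p.hx; omega))
  rwa [one_mul] at h

theorem norm_bPlus_le (q : Set.Ioo (0 : ℝ) 1) (p : Idx) : ‖(bPlus q p.n p.x p.y : ℂ)‖ ≤ 1 :=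
  norm_coeff_le_one (by rw [abs_neg]; exact abs_pow_le_one q _) (by positivity)
    (sqrt_quot_le_one q (by omega) (by have := p.hx; omega))

theorem norm_bMinus_le (q : Set.Ioo (0 : ℝ) 1) (p : Idx) : ‖(bMinus q p.n p.x p.y : ℂ)‖ ≤ 1 :=
  norm_coeff_le_one (abs_pow_le_one q _) (by positivity)
    (sqrt_quot_le_one q (by have := p.hy; omega) (by omega))

/-! ### The operators `α_±`, `β_±`, `α`, `β` -/

/-- `(n, x, y) ↦ (n + 1, x, y)`. -/
def raise : Idx → Idx := fun p => ⟨p.n + 1, p.x, p.y, p.hx.trans (Nat.le_succ _),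
  p.hy.trans (Nat.le_succ _)⟩

/-- `(n, x, y) ↦ (n + 1, x + 1, y)`. -/
def raiseX : Idx → Idx := fun p => ⟨p.n + 1, p.x + 1, p.y, Nat.succ_le_succ p.hx,
  p.hy.trans (Nat.le_succ _)⟩

/-- `(n, x, y) ↦ (n + 1, x, y + 1)`. -/
def raiseY : Idx → Idx := fun p => ⟨p.n + 1, p.x, p.y + 1, p.hx.trans (Nat.le_succ _),
  Nat.succ_le_succ p.hy⟩

/-- `(n, x, y) ↦ (n + 1, x + 1, y + 1)`. -/
def raiseXY : Idx → Idx := fun p => ⟨p.n + 1, p.x + 1, p.y + 1, Nat.succ_le_succ p.hx,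
  Nat.succ_le_succ p.hy⟩

theorem raise_injective : Function.Injective raise := fun p p' h => by
  simp only [raise, Idx.mk.injEq] at h; ext <;> omega

theorem raiseX_injective : Function.Injective raiseX := fun p p' h => by
  simp only [raiseX, Idx.mk.injEq] at h; ext <;> omega

theorem raiseY_injective : Function.Injective raiseY := fun p p' h => by
  simp only [raiseY, Idx.mk.injEq] at h; ext <;> omega

theorem raiseXY_injective : Function.Injective raiseXY := fun p p' h => by
  simp only [raiseXY, Idx.mk.injEq] at h; ext <;> omega

/-- `α_+ e^{(n/2)}_{i,j} = a_+(n/2,i,j) e^{((n+1)/2)}_{i-1/2,j-1/2}`. -/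
def alphaPlus (q : Set.Ioo (0 : ℝ) 1) : Hil →L[ℂ] Hil :=
  weightedShift (ofInjective raise raise_injective) (fun p => (aPlus q p.n p.x p.y : ℂ))
    (norm_aPlus_le q)

/-- `α_- e^{(n/2)}_{i,j} = a_-(n/2,i,j) e^{((n-1)/2)}_{i-1/2,j-1/2}`, which is `0` if `x = 0` or
`y = 0`. -/
def alphaMinus (q : Set.Ioo (0 : ℝ) 1) : Hil →L[ℂ] Hil :=
  weightedShift (ofInjective raiseXY raiseXY_injective).symm
    (fun p => (aMinus q p.n p.x p.y : ℂ)) (norm_aMinus_le q)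

/-- `β_+ e^{(n/2)}_{i,j} = b_+(n/2,i,j) e^{((n+1)/2)}_{i+1/2,j-1/2}`. -/
def betaPlus (q : Set.Ioo (0 : ℝ) 1) : Hil →L[ℂ] Hil :=
  weightedShift (ofInjective raiseX raiseX_injective) (fun p => (bPlus q p.n p.x p.y : ℂ))
    (norm_bPlus_le q)

/-- `β_- e^{(n/2)}_{i,j} = b_-(n/2,i,j) e^{((n-1)/2)}_{i+1/2,j-1/2}`, which is `0` if `y = 0` or
`x = n`. -/
def betaMinus (q : Set.Ioo (0 : ℝ) 1) : Hil →L[ℂ] Hil :=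
  weightedShift (ofInjective raiseY raiseY_injective).symm
    (fun p => (bMinus q p.n p.x p.y : ℂ)) (norm_bMinus_le q)

/-- The operator `α` of the standard representation. -/
def alpha (q : Set.Ioo (0 : ℝ) 1) : Hil →L[ℂ] Hil := alphaPlus q + alphaMinus q

/-- The operator `β` of the standard representation. -/
def beta (q : Set.Ioo (0 : ℝ) 1) : Hil →L[ℂ] Hil := betaPlus q + betaMinus q

/-- The algebra `𝒜` of `SU_q(2)`, acting on the Hilbert space: the unital `*`-algebra generated by
`α` and `β`. -/
def coordAlgebra (q : Set.Ioo (0 : ℝ) 1) : StarSubalgebra ℂ (Hil →L[ℂ] Hil) :=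
  StarAlgebra.adjoin ℂ {alpha q, beta q}

/-- The pseudo-differential algebra `ℬ`, generated by the operators `δ ^ k (a)`, `a ∈ 𝒜`, `k ∈ ℕ`.
(The set of these operators is stable under `T ↦ T*`, since `δ(T)* = -δ(T*)`.) -/
def pdoAlgebra (q : Set.Ioo (0 : ℝ) 1) : StarSubalgebra ℂ (Hil →L[ℂ] Hil) :=
  StarAlgebra.adjoin ℂ {S | ∃ a ∈ coordAlgebra q, ∃ k : ℕ, IsDeltaPow k a S}

/-! ### `α_±` and `β_±` belong to `ℬ` -/

theorem isDelta_weightedShift (e : Idx ≃. Idx) (c : Idx → ℂ) (hc : ∀ i, ‖c i‖ ≤ 1) (m : ℂ)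
    (hm : ∀ p p', e.symm p' = some p → (p'.n : ℂ) = p.n + m) :
    IsDelta (weightedShift e c hc) (m • weightedShift e c hc) := by
  intro ξ η h p'
  change weightedShift e c hc η p' + m * weightedShift e c hc ξ p' = _
  rw [weightedShift_apply, weightedShift_apply, abs_diracEigenvalue]
  cases hp : e.symm p' with
  | none => simp
  | some p =>
    have h1 := h p
    rw [abs_diracEigenvalue] at h1
    have h2 := hm p p' hp
    simp only [Option.elim, h1, Complex.ofReal_natCast, h2]
    ring

theorem IsDelta.add {T S T' S' : Hil →L[ℂ] Hil} (h : IsDelta T S) (h' : IsDelta T' S') :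
    IsDelta (T + T') (S + S') := by
  intro ξ η hξ p
  have h1 := h ξ η hξ p
  have h2 := h' ξ η hξ p
  simp only [add_apply, lp.coeFn_add, Pi.add_apply] at h1 h2 ⊢
  rw [mul_add, ← h1, ← h2]
  ring

theorem ofInjective_symm_eq_some {g : Idx → Idx} (hg : Function.Injective g) {p p' : Idx} :
    (ofInjective g hg).symm p' = some p ↔ g p = p' := by
  rw [PEquiv.eq_some_iff]
  exact Option.some_inj

theorem ofInjective_symm_symm_eq_some {g : Idx → Idx} (hg : Function.Injective g) {p p' : Idx} :
    (ofInjective g hg).symm.symm p' = some p ↔ g p' = p := by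
  rw [PEquiv.symm_symm]
  exact Option.some_inj

theorem isDelta_alpha (q : Set.Ioo (0 : ℝ) 1) :
    IsDelta (alpha q) ((1 : ℂ) • alphaPlus q + (-1 : ℂ) • alphaMinus q) := by
  refine (isDelta_weightedShift _ _ _ _ ?_).add (isDelta_weightedShift _ _ _ _ ?_)
  · intro p p' h
    rw [ofInjective_symm_eq_some] at h
    subst h
    simp [raise]
  · intro p p' h
    rw [ofInjective_symm_symm_eq_some] at h
    subst h
    simp [raiseXY]

theorem isDelta_beta (q : Set.Ioo (0 : ℝ) 1) :
    IsDelta (beta q) ((1 : ℂ) • betaPlus q + (-1 : ℂ) • betaMinus q) := by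
  refine (isDelta_weightedShift _ _ _ _ ?_).add (isDelta_weightedShift _ _ _ _ ?_)
  · intro p p' h
    rw [ofInjective_symm_eq_some] at h
    subst h
    simp [raiseX]
  · intro p p' h
    rw [ofInjective_symm_symm_eq_some] at h
    subst h
    simp [raiseY]

theorem mem_pdoAlgebra_of_isDelta (q : Set.Ioo (0 : ℝ) 1) {T S : Hil →L[ℂ] Hil}
    (hT : T ∈ coordAlgebra q) (h : IsDelta T S) (s t : ℂ) : s • T + t • S ∈ pdoAlgebra q :=
  add_mem
    (SMulMemClass.smul_mem s (StarAlgebra.subset_adjoin ℂ _ ⟨T, hT, 0, rfl⟩))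
    (SMulMemClass.smul_mem t (StarAlgebra.subset_adjoin ℂ _ ⟨T, hT, 1, T, rfl, h⟩))

theorem alpha_mem (q : Set.Ioo (0 : ℝ) 1) : alpha q ∈ coordAlgebra q :=
  StarAlgebra.subset_adjoin ℂ _ (Or.inl rfl)

theorem beta_mem (q : Set.Ioo (0 : ℝ) 1) : beta q ∈ coordAlgebra q :=
  StarAlgebra.subset_adjoin ℂ _ (Or.inr rfl)

theorem alphaPlus_mem (q : Set.Ioo (0 : ℝ) 1) : alphaPlus q ∈ pdoAlgebra q := by
  have h := mem_pdoAlgebra_of_isDelta q (alpha_mem q) (isDelta_alpha q) (1 / 2) (1 / 2)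
  convert h using 1
  rw [alpha]
  module

theorem alphaMinus_mem (q : Set.Ioo (0 : ℝ) 1) : alphaMinus q ∈ pdoAlgebra q := by
  have h := mem_pdoAlgebra_of_isDelta q (alpha_mem q) (isDelta_alpha q) (1 / 2) (-(1 / 2))
  convert h using 1
  rw [alpha]
  module

theorem betaPlus_mem (q : Set.Ioo (0 : ℝ) 1) : betaPlus q ∈ pdoAlgebra q := by
  have h := mem_pdoAlgebra_of_isDelta q (beta_mem q) (isDelta_beta q) (1 / 2) (1 / 2)
  convert h using 1
  rw [beta]
  module

theorem betaMinus_mem (q : Set.Ioo (0 : ℝ) 1) : betaMinus q ∈ pdoAlgebra q := by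
  have h := mem_pdoAlgebra_of_isDelta q (beta_mem q) (isDelta_beta q) (1 / 2) (-(1 / 2))
  convert h using 1
  rw [beta]
  module

/-! ### The algebra `C^∞(S¹)` -/

/-- The algebra `C^∞(S¹)` of smooth complex functions on the unit circle. -/
def SmoothCircle : StarSubalgebra ℂ C(Circle, ℂ) where
  carrier := {f | ContDiff ℝ ∞ fun t : ℝ => f (Circle.exp t)}
  mul_mem' {f g} hf hg := by
    have hf' : ContDiff ℝ ∞ fun t : ℝ => f (Circle.exp t) := hf
    have hg' : ContDiff ℝ ∞ fun t : ℝ => g (Circle.exp t) := hg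
    exact hf'.mul hg'
  add_mem' {f g} hf hg := by
    have hf' : ContDiff ℝ ∞ fun t : ℝ => f (Circle.exp t) := hf
    have hg' : ContDiff ℝ ∞ fun t : ℝ => g (Circle.exp t) := hg
    exact hf'.add hg'
  algebraMap_mem' c := by
    have h : ContDiff ℝ ∞ fun _ : ℝ => c := contDiff_const
    exact h
  star_mem' {f} hf := by
    have hf' : ContDiff ℝ ∞ fun t : ℝ => f (Circle.exp t) := hf
    exact Complex.conjCLE.contDiff.comp hf'

/-- The canonical generator `u = e^{iθ}` of `C^∞(S¹)`. -/
def circleU : SmoothCircle :=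
  ⟨⟨fun z => (z : ℂ), continuous_subtype_val⟩, by
    change ContDiff ℝ ∞ fun t : ℝ => ((Circle.exp t : Circle) : ℂ)
    simp only [Circle.coe_exp]
    exact (Complex.ofRealCLM.contDiff.mul contDiff_const).cexp⟩

/-! ### The algebras `C^∞(D²_{q±})` -/

/-- The Fourier coefficient of index `m` of a function on the circle. -/
def fourierCoef (f : C(Circle, ℂ)) (m : ℤ) : ℂ :=
  (1 / (2 * Real.pi) : ℝ) *
    ∫ t in (0 : ℝ)..(2 * Real.pi), f (Circle.exp t) * Complex.exp (-(m * t * Complex.I))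

/-- Infinite matrices of rapid decay. -/
def RapidDecay (R : ℕ → ℕ → ℂ) : Prop :=
  ∀ k : ℕ, ∃ C : ℝ, ∀ x y : ℕ, (1 + x + y : ℝ) ^ k * ‖R x y‖ ≤ C

/-- The smooth Toeplitz algebra on `ℓ²(ℕ)`, which is the algebra `C^∞(D²_{q+})`, and also
`C^∞(D²_{q-})`, in its defining representation `π_±`; the two differ only in the generator `β`.
It consists of the operators `T_f + R`, where `R` is a matrix of rapid decay and `T_f` the Toeplitz
operator with smooth symbol `f` (with `T_u ε_x = ε_{x-1}`, so that `f` is the image of `T_f + R`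
under the symbol homomorphism to `C^∞(S¹)`, whose kernel is formed by the matrices of rapid decay).
These operators are stable under sums, products and adjoints, so `StarAlgebra.adjoin` adds
nothing to them. -/
def SmoothDisk : StarSubalgebra ℂ (Ell2 ℕ →L[ℂ] Ell2 ℕ) :=
  StarAlgebra.adjoin ℂ {T | ∃ f ∈ SmoothCircle, ∃ R : ℕ → ℕ → ℂ, RapidDecay R ∧
    ∀ x y : ℕ, T (ket y) x = fourierCoef f ((y : ℤ) - (x : ℤ)) + R x y}

theorem norm_sqrt_le (q : Set.Ioo (0 : ℝ) 1) (k : ℕ) : ‖(√(1 - (q : ℝ) ^ k) : ℂ)‖ ≤ 1 := by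
  rw [Complex.norm_real, Real.norm_eq_abs, abs_of_nonneg (Real.sqrt_nonneg _)]
  exact Real.sqrt_le_one.2 (sub_le_self _ (pow_nonneg q.2.1.le _))

/-- The operator `π_±(α)`: `ε_x ↦ (1 - q^{2x})^{1/2} ε_{x-1}`, `ε_0 ↦ 0`. -/
def diskAlphaOp (q : Set.Ioo (0 : ℝ) 1) : Ell2 ℕ →L[ℂ] Ell2 ℕ :=
  weightedShift (ofInjective Nat.succ Nat.succ_injective).symm
    (fun x => (√(1 - (q : ℝ) ^ (2 * x)) : ℂ)) (fun _ => norm_sqrt_le q _)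

/-- The operator `π_+(β)`: `ε_x ↦ q^x ε_x`. -/
def diskBetaOp (q : Set.Ioo (0 : ℝ) 1) : Ell2 ℕ →L[ℂ] Ell2 ℕ :=
  weightedShift (PEquiv.refl ℕ) (fun x => ((q : ℝ) ^ x : ℝ)) (fun x => by
    rw [Complex.norm_real]; exact abs_pow_le_one q x)

/-! ### The generators of `C^∞(D²_{q±})` -/

theorem fourierCoef_circleU (m : ℤ) :
    fourierCoef (circleU : C(Circle, ℂ)) m = if m = 1 then 1 else 0 := by
  have hpi : (Real.pi : ℂ) ≠ 0 := Complex.ofReal_ne_zero.2 Real.pi_ne_zero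
  have h : ∀ t : ℝ, (circleU : C(Circle, ℂ)) (Circle.exp t) * Complex.exp (-(m * t * Complex.I))
      = Complex.exp ((1 - m) * Complex.I * t) := by
    intro t
    change ((Circle.exp t : Circle) : ℂ) * _ = _
    rw [Circle.coe_exp, ← Complex.exp_add]
    congr 1
    ring
  rw [fourierCoef]
  simp only [h]
  split_ifs with hm
  · subst hm
    simp only [Int.cast_one, sub_self, zero_mul, Complex.exp_zero, intervalIntegral.integral_const,
      sub_zero]
    rw [← Complex.coe_smul]
    push_cast
    simp only [smul_eq_mul, mul_one]
    field_simp
  · have hm' : ((1 : ℂ) - m) * Complex.I ≠ 0 := by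
      refine mul_ne_zero (sub_ne_zero.2 fun h' => hm ?_) Complex.I_ne_zero
      exact_mod_cast h'.symm
    rw [integral_exp_mul_complex hm']
    have h1 : Complex.exp ((1 - m) * Complex.I * ((2 * Real.pi : ℝ) : ℂ)) = 1 := by
      rw [Complex.exp_eq_one_iff]
      exact ⟨1 - m, by push_cast; ring⟩
    rw [h1]
    simp

theorem exists_bound_pow_mul (q : Set.Ioo (0 : ℝ) 1) (k : ℕ) :
    ∃ C : ℝ, ∀ x : ℕ, (1 + 2 * x : ℝ) ^ k * (q : ℝ) ^ x ≤ C := by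
  have hq0 : (0 : ℝ) < q := q.2.1
  have hs : Summable fun n : ℕ => (n : ℝ) ^ k * (q : ℝ) ^ n :=
    summable_pow_mul_geometric_of_norm_lt_one k (by
      rw [Real.norm_eq_abs, abs_of_pos hq0]; exact q.2.2)
  refine ⟨2 ^ k * (q : ℝ)⁻¹ * ∑' n : ℕ, (n : ℝ) ^ k * (q : ℝ) ^ n, fun x => ?_⟩
  have h1 := hs.le_tsum (x + 1) (fun j _ => by positivity)
  have h2 : (1 + 2 * x : ℝ) ^ k ≤ 2 ^ k * ((x + 1 : ℕ) : ℝ) ^ k := by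
    rw [← mul_pow]
    refine pow_le_pow_left₀ (by positivity) ?_ k
    push_cast
    linarith
  calc (1 + 2 * x : ℝ) ^ k * (q : ℝ) ^ x
      ≤ 2 ^ k * ((x + 1 : ℕ) : ℝ) ^ k * (q : ℝ) ^ x := by gcongr
    _ = 2 ^ k * (q : ℝ)⁻¹ * (((x + 1 : ℕ) : ℝ) ^ k * (q : ℝ) ^ (x + 1)) := by
        rw [pow_succ]
        field_simp
    _ ≤ _ := by gcongr

theorem rapidDecay_of_le (q : Set.Ioo (0 : ℝ) 1) {R : ℕ → ℕ → ℂ}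
    (h0 : ∀ x y, y < x → R x y = 0) (h : ∀ x y, ‖R x y‖ ≤ (q : ℝ) ^ y) : RapidDecay R := by
  intro k
  obtain ⟨C, hC⟩ := exists_bound_pow_mul q k
  refine ⟨C, fun x y => ?_⟩
  have hC0 := hC y
  by_cases hxy : y < x
  · rw [h0 x y hxy, norm_zero, mul_zero]
    have hq0 : (0 : ℝ) < q := q.2.1
    exact le_trans (by positivity) hC0
  · refine le_trans (mul_le_mul (pow_le_pow_left₀ (by positivity) ?_ k) (h x y) (norm_nonneg _)
      (by positivity)) hC0
    have : (x : ℝ) ≤ y := by exact_mod_cast not_lt.1 hxy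
    linarith

theorem diskBetaOp_mem (q : Set.Ioo (0 : ℝ) 1) : diskBetaOp q ∈ SmoothDisk := by
  refine StarAlgebra.subset_adjoin ℂ _ ⟨0, zero_mem _,
    fun x y => if x = y then (((q : ℝ) ^ y : ℝ) : ℂ) else 0, rapidDecay_of_le q ?_ ?_, ?_⟩
  · intro x y hxy
    simp [hxy.ne']
  · intro x y
    have hq0 : (0 : ℝ) < q := q.2.1
    split_ifs
    · rw [Complex.norm_real, Real.norm_eq_abs, abs_of_pos (by positivity)]
    · rw [norm_zero]; positivity
  · intro x y
    rw [diskBetaOp, weightedShift_ket]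
    by_cases h : x = y <;> simp [fourierCoef, ket_apply, h]

theorem diskAlphaOp_mem (q : Set.Ioo (0 : ℝ) 1) : diskAlphaOp q ∈ SmoothDisk := by
  have hq0 : (0 : ℝ) < q := q.2.1
  refine StarAlgebra.subset_adjoin ℂ _ ⟨circleU, circleU.2,
    fun x y => if y = x + 1 then ((√(1 - (q : ℝ) ^ (2 * y)) - 1 : ℝ) : ℂ) else 0,
    rapidDecay_of_le q ?_ ?_, ?_⟩
  · intro x y hxy
    rw [if_neg (by omega)]
  · intro x y
    split_ifs
    · have hs : (q : ℝ) ^ (2 * y) ≤ 1 := pow_le_one₀ hq0.le q.2.2.le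
      have hs0 : 0 ≤ (q : ℝ) ^ (2 * y) := by positivity
      have h1 : √(1 - (q : ℝ) ^ (2 * y)) ≤ 1 := Real.sqrt_le_one.2 (by linarith)
      have h2 : 1 - (q : ℝ) ^ (2 * y) ≤ √(1 - (q : ℝ) ^ (2 * y)) :=
        Real.le_sqrt_of_sq_le (by nlinarith)
      have h3 : (q : ℝ) ^ (2 * y) ≤ (q : ℝ) ^ y :=
        pow_le_pow_of_le_one hq0.le q.2.2.le (by omega)
      rw [Complex.norm_real, Real.norm_eq_abs, abs_le]
      constructor <;> linarith
    · rw [norm_zero]; positivity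
  · intro x y
    rw [fourierCoef_circleU, diskAlphaOp, weightedShift_apply, PEquiv.symm_symm]
    change (√(1 - (q : ℝ) ^ (2 * (x + 1))) : ℂ) * (ket y : Ell2 ℕ) (x + 1) = _
    rw [ket_apply]
    beta_reduce
    by_cases h : y = x + 1
    · subst h
      simp
    · rw [if_neg (fun h' => h h'.symm), if_neg (by omega), if_neg h]
      simp

/-- The class `r_±(α)` in `C^∞(D²_{q±})`. -/
def diskAlpha (q : Set.Ioo (0 : ℝ) 1) : SmoothDisk := ⟨diskAlphaOp q, diskAlphaOp_mem q⟩

/-- The class `r_+(β)` in `C^∞(D²_{q+})`: the operator `π_+(β)`, `ε_x ↦ q^x ε_x`. -/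
def diskBetaPlus (q : Set.Ioo (0 : ℝ) 1) : SmoothDisk := ⟨diskBetaOp q, diskBetaOp_mem q⟩

/-- The class `r_-(β)` in `C^∞(D²_{q-})`: the operator `π_-(β)`, `ε_x ↦ -q^x ε_x`. -/
def diskBetaMinus (q : Set.Ioo (0 : ℝ) 1) : SmoothDisk := -diskBetaPlus q

end SUq2

end

open SUq2

noncomputable section

namespace SUq2

/-! ### Kets and inner products -/

/-! Uniqueness is algebraic. The operator `|D|` has eigenvalue `n`, and `α_±`, `β_±` change `n` by
`±1`, so `δ` multiplies each of them by `±1`. The span of the `δ`-homogeneous elements of the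
`*`-algebra generated by these four operators contains `𝒜` and is stable under products, adjoints
and `δ`. Hence it contains every `δ^k(a)`, and `ℬ` is the `*`-algebra generated by `α_±`, `β_±`
(`pdoAlgebra_eq_adjoin_generators`). A `*`-homomorphism on `ℬ` is therefore determined by the four
prescribed values.

Existence comes from a limit `n → ∞` with `x`, `y` fixed. There the coefficients of the generators
converge to products of a function of `x` and a function of `y`, which are the coefficients of the
prescribed tensors on `ε_x ⊗ ε_y ⊗ u^r`; the exponent `r` records the level relative to a moving
origin `N`, so that raising `n` becomes multiplication by `u`. Accordingly, `T` is called asymptotic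
to `t` if, for each finitely supported `v`, the vector `t v` is some finitely supported `w` and `T`
maps the translate of `v` by `N` to that of `w`, up to an error tending to `0` in norm. The
existence of `w` is part of the condition, since a general `t` does not preserve finite support.

This relation respects sums and, by continuity of the operators, products. It is also single-valued:
if `0` is asymptotic to `t`, then `t` kills all `ε_x ⊗ ε_y ⊗ 1`, because translation loses no
finitely supported vector in the limit (`eq_zero_of_tendsto_translate`), and the target acts
faithfully on these vectors (`eq_zero_of_targetRep_eq_zero`). Requiring the relation for `T` and for
its adjoint gives stability under `*`. The eight computations for the generators and their adjoints
then show that every element of `ℬ` has exactly one symbol, and the symbol map is the desired `ρ`.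
-/

theorem inner_ket {ι : Type} (i : ι) (ξ : Ell2 ι) : inner ℂ (ket i) ξ = ξ i := by
  classical
  rw [ket, lp.inner_single_left]
  simp

theorem ext_ket {ι : Type} {V : Type*} [NormedAddCommGroup V] [NormedSpace ℂ V]
    {S T : Ell2 ι →L[ℂ] V} (h : ∀ i, S (ket i) = T (ket i)) : S = T := by
  classical
  have hk : ∀ (i : ι) (z : ℂ), lp.single 2 i z = z • (ket i : Ell2 ι) := by
    intro i z
    ext j
    rw [lp.coeFn_smul, Pi.smul_apply, ket_apply]
    by_cases hj : j = i
    · subst hj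
      simp
    · simp [hj]
  ext1 ξ
  have hξ := lp.hasSum_single (p := 2) (by norm_num) ξ
  refine (hξ.mapL S).unique ?_
  convert hξ.mapL T using 2 with i
  rw [hk, map_smul, map_smul, h]

theorem star_weightedShift_ket {ι : Type} (e : ι ≃. ι) (c : ι → ℂ) (hc : ∀ i, ‖c i‖ ≤ 1) (j : ι) :
    star (weightedShift e c hc) (ket j) =
      (e.symm j).elim 0 (fun i => star (c i) • ket i) := by
  classical
  ext i
  rw [← inner_ket i, ContinuousLinearMap.star_eq_adjoint, ContinuousLinearMap.adjoint_inner_right,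
    ← inner_conj_symm, inner_ket, weightedShift_apply]
  cases e.symm j with
  | none => simp
  | some i' =>
    simp only [Option.elim, lp.coeFn_smul, Pi.smul_apply, ket_apply, smul_eq_mul]
    by_cases h : i = i'
    · simp [h]
    · simp [h, Ne.symm h]

/-! ### The derivation `δ` -/

theorem IsAbsD.inner_eq {ξ η ξ' η' : Hil} (h : IsAbsD ξ η) (h' : IsAbsD ξ' η') :
    inner ℂ ξ' η = inner ℂ η' ξ := by
  refine (lp.hasSum_inner ξ' η).unique ?_
  convert lp.hasSum_inner η' ξ using 2 with p
  rw [h p, h' p]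
  simp only [RCLike.inner_apply, map_mul, Complex.conj_ofReal]
  ring

theorem isAbsD_ket (p : Idx) : IsAbsD (ket p) ((p.n : ℂ) • ket p) := by
  classical
  intro p'
  rw [abs_diracEigenvalue, lp.coeFn_smul, Pi.smul_apply, ket_apply]
  by_cases h : p' = p
  · subst h
    simp
  · simp [h]

/-- Basis vectors lie in the domain of `|D|`, and a bounded operator is determined by its values on
them. -/
theorem IsDelta.unique {T S S' : Hil →L[ℂ] Hil} (h : IsDelta T S) (h' : IsDelta T S') :
    S = S' := by
  refine ext_ket fun p => ?_
  have h1 := h _ _ (isAbsD_ket p)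
  have h2 := h' _ _ (isAbsD_ket p)
  refine add_left_cancel (a := T ((p.n : ℂ) • ket p)) ?_
  ext p'
  rw [h1 p', h2 p']

theorem IsDelta.mul {T S T' S' : Hil →L[ℂ] Hil} (h : IsDelta T S) (h' : IsDelta T' S') :
    IsDelta (T * T') (S * T' + T * S') := by
  intro ξ η hξ
  have h1 := h _ _ (h' ξ η hξ)
  simp only [mul_apply_eq_comp, add_apply, map_add] at h1 ⊢
  convert h1 using 1
  abel

theorem IsDelta.smul {T S : Hil →L[ℂ] Hil} (h : IsDelta T S) (c : ℂ) :
    IsDelta (c • T) (c • S) := by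
  intro ξ η hξ p
  have h1 := h ξ η hξ p
  simp only [smul_apply, lp.coeFn_smul, Pi.smul_apply, lp.coeFn_add, Pi.add_apply] at h1 ⊢
  rw [← smul_add, h1, smul_eq_mul, smul_eq_mul]
  ring

theorem isDelta_algebraMap (c : ℂ) : IsDelta (algebraMap ℂ (Hil →L[ℂ] Hil) c) 0 := by
  intro ξ η hξ p
  have h1 := hξ p
  simp only [Algebra.algebraMap_eq_smul_one, smul_apply, one_apply_eq_self,
    zero_apply, add_zero, lp.coeFn_smul, Pi.smul_apply, smul_eq_mul] at h1 ⊢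
  rw [h1]
  ring

theorem IsDelta.star {T S : Hil →L[ℂ] Hil} (h : IsDelta T S) : IsDelta (star T) (-star S) := by
  intro ξ η hξ p
  -- The domain condition is coordinatewise, so it suffices to pair with each basis vector and move
  -- `|D|` across the inner product by symmetry.
  have h1 := hξ.inner_eq (h _ _ (isAbsD_ket p))
  rw [← inner_ket p, ← inner_ket p]
  simp only [neg_apply, ContinuousLinearMap.star_eq_adjoint, inner_add_right, inner_neg_right,
    ContinuousLinearMap.adjoint_inner_right]
  rw [h1, map_smul, inner_add_left, inner_smul_left, abs_diracEigenvalue]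
  simp

/-! ### `ℬ` is generated by `α_±` and `β_±` -/

/-- The four homogeneous generators of `ℬ`. -/
def generators (q : Set.Ioo (0 : ℝ) 1) : Set (Hil →L[ℂ] Hil) :=
  {alphaPlus q, alphaMinus q, betaPlus q, betaMinus q}

/-- The linear span of the operators in the `*`-algebra generated by `α_±` and `β_±` which are
homogeneous with respect to `δ`. -/
def homogeneousSpan (q : Set.Ioo (0 : ℝ) 1) : Submodule ℂ (Hil →L[ℂ] Hil) :=
  Submodule.span ℂ {T | T ∈ StarAlgebra.adjoin ℂ (generators q) ∧ ∃ r : ℤ, IsDelta T ((r : ℂ) • T)}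

theorem homogeneousSpan_le (q : Set.Ioo (0 : ℝ) 1) {T : Hil →L[ℂ] Hil}
    (hT : T ∈ homogeneousSpan q) : T ∈ StarAlgebra.adjoin ℂ (generators q) := by
  induction hT using Submodule.span_induction with
  | mem T h => exact h.1
  | zero => exact zero_mem _
  | add S T _ _ hS hT => exact add_mem hS hT
  | smul c T _ hT => exact SMulMemClass.smul_mem c hT

theorem mul_mem_homogeneousSpan (q : Set.Ioo (0 : ℝ) 1) {S T : Hil →L[ℂ] Hil}
    (hS : S ∈ homogeneousSpan q) (hT : T ∈ homogeneousSpan q) : S * T ∈ homogeneousSpan q := by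
  induction hS using Submodule.span_induction with
  | zero => rw [zero_mul]; exact zero_mem _
  | add S S' _ _ h h' => rw [add_mul]; exact add_mem h h'
  | smul c S _ h => rw [smul_mul_assoc]; exact Submodule.smul_mem _ c h
  | mem S h =>
    obtain ⟨hS, r, hr⟩ := h
    induction hT using Submodule.span_induction with
    | zero => rw [mul_zero]; exact zero_mem _
    | add S S' _ _ h h' => rw [mul_add]; exact add_mem h h'
    | smul c S _ h => rw [mul_smul_comm]; exact Submodule.smul_mem _ c h
    | mem T h =>
      obtain ⟨hT, s, hs⟩ := h
      refine Submodule.subset_span ⟨mul_mem hS hT, r + s, ?_⟩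
      convert hr.mul hs using 1
      rw [smul_mul_assoc, mul_smul_comm, ← add_smul]
      push_cast
      rfl

theorem star_mem_homogeneousSpan (q : Set.Ioo (0 : ℝ) 1) {T : Hil →L[ℂ] Hil}
    (hT : T ∈ homogeneousSpan q) : star T ∈ homogeneousSpan q := by
  induction hT using Submodule.span_induction with
  | zero => rw [star_zero]; exact zero_mem _
  | add S S' _ _ h h' => rw [star_add]; exact add_mem h h'
  | smul c S _ h => rw [star_smul]; exact Submodule.smul_mem _ _ h
  | mem T h =>
    obtain ⟨hT, r, hr⟩ := h
    refine Submodule.subset_span ⟨star_mem hT, -r, ?_⟩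
    convert hr.star using 1
    rw [star_smul]
    simp

/-- Homogeneous operators are eigenvectors of `δ`, so their span lies in its domain and is mapped to
itself. Since `δ(T)` is unique, the iterates of `δ` on `𝒜` cannot leave the span. -/
theorem exists_isDelta_of_mem_homogeneousSpan (q : Set.Ioo (0 : ℝ) 1) {T : Hil →L[ℂ] Hil}
    (hT : T ∈ homogeneousSpan q) : ∃ S ∈ homogeneousSpan q, IsDelta T S := by
  induction hT using Submodule.span_induction with
  | mem T h =>
    obtain ⟨hT, r, hr⟩ := h
    exact ⟨_, Submodule.smul_mem _ _ (Submodule.subset_span ⟨hT, r, hr⟩), hr⟩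
  | zero => exact ⟨0, zero_mem _, by simpa using isDelta_algebraMap 0⟩
  | add S T _ _ hS hT =>
    obtain ⟨S', hS', h⟩ := hS
    obtain ⟨T', hT', h'⟩ := hT
    exact ⟨S' + T', add_mem hS' hT', h.add h'⟩
  | smul c T _ hT =>
    obtain ⟨T', hT', h'⟩ := hT
    exact ⟨c • T', Submodule.smul_mem _ _ hT', h'.smul c⟩

theorem alphaPlus_mem_homogeneousSpan (q : Set.Ioo (0 : ℝ) 1) :
    alphaPlus q ∈ homogeneousSpan q := by
  refine Submodule.subset_span ⟨StarAlgebra.subset_adjoin ℂ _ (by simp [generators]), 1,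
    isDelta_weightedShift _ _ _ _ fun p p' h => ?_⟩
  rw [ofInjective_symm_eq_some] at h
  simp [← h, raise]

theorem alphaMinus_mem_homogeneousSpan (q : Set.Ioo (0 : ℝ) 1) :
    alphaMinus q ∈ homogeneousSpan q := by
  refine Submodule.subset_span ⟨StarAlgebra.subset_adjoin ℂ _ (by simp [generators]), -1,
    isDelta_weightedShift _ _ _ _ fun p p' h => ?_⟩
  rw [ofInjective_symm_symm_eq_some] at h
  simp [← h, raiseXY]

theorem betaPlus_mem_homogeneousSpan (q : Set.Ioo (0 : ℝ) 1) :
    betaPlus q ∈ homogeneousSpan q := by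
  refine Submodule.subset_span ⟨StarAlgebra.subset_adjoin ℂ _ (by simp [generators]), 1,
    isDelta_weightedShift _ _ _ _ fun p p' h => ?_⟩
  rw [ofInjective_symm_eq_some] at h
  simp [← h, raiseX]

theorem betaMinus_mem_homogeneousSpan (q : Set.Ioo (0 : ℝ) 1) :
    betaMinus q ∈ homogeneousSpan q := by
  refine Submodule.subset_span ⟨StarAlgebra.subset_adjoin ℂ _ (by simp [generators]), -1,
    isDelta_weightedShift _ _ _ _ fun p p' h => ?_⟩
  rw [ofInjective_symm_symm_eq_some] at h
  simp [← h, raiseY]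

theorem coordAlgebra_le_homogeneousSpan (q : Set.Ioo (0 : ℝ) 1) {T : Hil →L[ℂ] Hil}
    (hT : T ∈ coordAlgebra q) : T ∈ homogeneousSpan q := by
  induction hT using StarAlgebra.adjoin_induction with
  | mem T h =>
    rcases h with rfl | rfl
    · exact add_mem (alphaPlus_mem_homogeneousSpan q) (alphaMinus_mem_homogeneousSpan q)
    · exact add_mem (betaPlus_mem_homogeneousSpan q) (betaMinus_mem_homogeneousSpan q)
  | algebraMap c =>
    exact Submodule.subset_span ⟨algebraMap_mem _ c, 0, by simpa using isDelta_algebraMap c⟩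
  | add S T _ _ hS hT => exact add_mem hS hT
  | mul S T _ _ hS hT => exact mul_mem_homogeneousSpan q hS hT
  | star T _ hT => exact star_mem_homogeneousSpan q hT

theorem IsDeltaPow.mem_homogeneousSpan (q : Set.Ioo (0 : ℝ) 1) {T : Hil →L[ℂ] Hil}
    (hT : T ∈ coordAlgebra q) (k : ℕ) {S : Hil →L[ℂ] Hil} (h : IsDeltaPow k T S) :
    S ∈ homogeneousSpan q := by
  induction k generalizing S with
  | zero =>
    have h' : S = T := h
    exact h' ▸ coordAlgebra_le_homogeneousSpan q hT
  | succ k ih =>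
    obtain ⟨R, hR, hRS⟩ := h
    obtain ⟨S', hS', hRS'⟩ := exists_isDelta_of_mem_homogeneousSpan q (ih hR)
    exact hRS.unique hRS' ▸ hS'

theorem pdoAlgebra_eq_adjoin_generators (q : Set.Ioo (0 : ℝ) 1) :
    pdoAlgebra q = StarAlgebra.adjoin ℂ (generators q) := by
  refine le_antisymm (StarAlgebra.adjoin_le ?_) (StarAlgebra.adjoin_le ?_)
  · rintro S ⟨a, ha, k, hk⟩
    exact homogeneousSpan_le q (hk.mem_homogeneousSpan q ha k)
  · rintro S (rfl | rfl | rfl | rfl)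
    · exact alphaPlus_mem q
    · exact alphaMinus_mem q
    · exact betaPlus_mem q
    · exact betaMinus_mem q

open Filter Topology

/-! ### Jointly injective families on tensor products -/

section JointlyInjective

variable {V V' W W' : Type*} [AddCommGroup V] [AddCommGroup V'] [AddCommGroup W] [AddCommGroup W']
  [Module ℂ V] [Module ℂ V'] [Module ℂ W] [Module ℂ W']

/-- Coordinates with respect to a basis of `W` identify `V ⊗ W` with finitely supported families in
`V`, on which `f i ⊗ id` acts entry by entry. -/
theorem eq_zero_of_forall_rTensor {ι : Type*} (f : ι → V →ₗ[ℂ] V')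
    (hf : ∀ v, (∀ i, f i v = 0) → v = 0) (t : V ⊗[ℂ] W) (ht : ∀ i, (f i).rTensor W t = 0) :
    t = 0 := by
  classical
  let b := Module.Free.chooseBasis ℂ W
  refine (TensorProduct.equivFinsuppOfBasisRight b).injective ?_
  rw [map_zero]
  ext j
  refine hf _ fun i => ?_
  have key : ∀ t : V ⊗[ℂ] W, TensorProduct.equivFinsuppOfBasisRight b ((f i).rTensor W t) j =
      f i (TensorProduct.equivFinsuppOfBasisRight b t j) := by
    intro t
    induction t with
    | zero => simp
    | add s t hs ht => simp [hs, ht]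
    | tmul v w => simp
  rw [← key, ht]
  simp

theorem eq_zero_of_forall_lTensor {ι : Type*} (g : ι → W →ₗ[ℂ] W')
    (hg : ∀ w, (∀ i, g i w = 0) → w = 0) (t : V ⊗[ℂ] W) (ht : ∀ i, (g i).lTensor V t = 0) :
    t = 0 := by
  refine (TensorProduct.comm ℂ V W).injective ?_
  rw [map_zero]
  refine eq_zero_of_forall_rTensor g hg _ fun i => ?_
  rw [LinearMap.rTensor, TensorProduct.map_comm, ← LinearMap.lTensor, ht, map_zero]

theorem eq_zero_of_forall_map {ι κ : Type*} (f : ι → V →ₗ[ℂ] V') (g : κ → W →ₗ[ℂ] W')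
    (hf : ∀ v, (∀ i, f i v = 0) → v = 0) (hg : ∀ w, (∀ i, g i w = 0) → w = 0) (t : V ⊗[ℂ] W)
    (ht : ∀ i j, TensorProduct.map (f i) (g j) t = 0) : t = 0 := by
  refine eq_zero_of_forall_rTensor f hf t fun i => eq_zero_of_forall_lTensor g hg _ fun j => ?_
  rw [← LinearMap.comp_apply, LinearMap.lTensor_comp_rTensor, ht]

end JointlyInjective

/-! ### The representation of the target algebra -/

/-- The space on which `C^∞(D²_{q+}) ⊗ C^∞(D²_{q-}) ⊗ C^∞(S¹)` acts. -/
abbrev TargetModule : Type := (Ell2 ℕ ⊗[ℂ] Ell2 ℕ) ⊗[ℂ] (Circle → ℂ)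

/-- The target algebra `C^∞(D²_{q+}) ⊗ C^∞(D²_{q-}) ⊗ C^∞(S¹)`. -/
abbrev TargetAlgebra : Type := SmoothDisk ⊗[ℂ] SmoothDisk ⊗[ℂ] SmoothCircle

/-- The defining representation of the smooth Toeplitz algebra. -/
def diskRep : SmoothDisk →ₐ[ℂ] Module.End ℂ (Ell2 ℕ) where
  toFun T := ((T : Ell2 ℕ →L[ℂ] Ell2 ℕ) : Ell2 ℕ →ₗ[ℂ] Ell2 ℕ)
  map_one' := rfl
  map_mul' _ _ := rfl
  map_zero' := rfl
  map_add' _ _ := rfl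
  commutes' _ := rfl

/-- The representation of `C^∞(S¹)` by multiplication on functions. -/
def circleRep : SmoothCircle →ₐ[ℂ] Module.End ℂ (Circle → ℂ) :=
  (Algebra.lmul ℂ (Circle → ℂ)).comp
    ((ContinuousMap.coeFnAlgHom ℂ).comp SmoothCircle.subtype.toAlgHom)

/-- The representation of the target algebra. -/
def targetRep : TargetAlgebra →ₐ[ℂ] Module.End ℂ TargetModule :=
  (Module.endTensorEndAlgHom (R := ℂ) (S := ℂ) (A := ℂ)).comp (Algebra.TensorProduct.map
    ((Module.endTensorEndAlgHom (R := ℂ) (S := ℂ) (A := ℂ)).comp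
      (Algebra.TensorProduct.map diskRep diskRep)) circleRep)

theorem targetRep_tmul (a b : SmoothDisk) (f : SmoothCircle) (ξ η : Ell2 ℕ) (g : Circle → ℂ) :
    targetRep (a ⊗ₜ b ⊗ₜ f) (ξ ⊗ₜ η ⊗ₜ g) =
      (a : Ell2 ℕ →L[ℂ] Ell2 ℕ) ξ ⊗ₜ (b : Ell2 ℕ →L[ℂ] Ell2 ℕ) η ⊗ₜ
        (fun z => (f : C(Circle, ℂ)) z * g z) := rfl

/-- The vector `ε_x ⊗ ε_y ⊗ u ^ r`. -/
def targetKet (i : ℕ × ℕ × ℤ) : TargetModule :=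
  (ket i.1 ⊗ₜ ket i.2.1) ⊗ₜ fun z => (z : ℂ) ^ i.2.2

/-- Faithfulness, already on the vectors of circle degree `0`: a disk operator is determined by its
values on kets, and a function on the circle by its product with `1`. These evaluations are jointly
injective on each factor, hence on the algebraic tensor product. -/
theorem eq_zero_of_targetRep_eq_zero (t : TargetAlgebra)
    (h : ∀ x y, targetRep t (targetKet (x, y, 0)) = 0) : t = 0 := by
  let ev : ℕ → SmoothDisk →ₗ[ℂ] Ell2 ℕ := fun x =>
    (LinearMap.applyₗ (ket x : Ell2 ℕ)).comp diskRep.toLinearMap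
  have hev : ∀ a, (∀ x, ev x a = 0) → a = 0 := by
    intro a ha
    refine Subtype.ext (ext_ket fun x => ?_)
    exact ha x
  let ev₁ : SmoothCircle →ₗ[ℂ] (Circle → ℂ) :=
    (LinearMap.applyₗ (fun z : Circle => (z : ℂ) ^ (0 : ℤ))).comp circleRep.toLinearMap
  have hev₁ : ∀ f, (∀ _ : Unit, ev₁ f = 0) → f = 0 := by
    intro f hf
    refine Subtype.ext (ContinuousMap.ext fun z => ?_)
    have h1 := congr_fun (hf ()) z
    change (f : C(Circle, ℂ)) z * (z : ℂ) ^ (0 : ℤ) = 0 at h1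
    simpa using h1
  refine eq_zero_of_forall_map (fun i : ℕ × ℕ => TensorProduct.map (ev i.1) (ev i.2))
    (fun _ : Unit => ev₁) ?_ hev₁ t ?_
  · intro s hs
    exact eq_zero_of_forall_map ev ev hev hev s fun x y => hs (x, y)
  · rintro ⟨x, y⟩ _
    rw [← h x y]
    clear h
    induction t using TensorProduct.induction_on with
    | zero => simp
    | add s t hs ht => simp only [map_add, hs, ht, LinearMap.add_apply]
    | tmul s f =>
      induction s using TensorProduct.induction_on with
      | zero => simp
      | add s s' hs hs' =>
        simp only [map_add, hs, hs', LinearMap.add_apply, TensorProduct.add_tmul]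
      | tmul a b => rfl

/-! ### Asymptotics of operators -/

/-- The basis vector of the Hilbert space with labels `n`, `x`, `y`, and `0` if there is none. -/
def ketZ (n : ℤ) (x y : ℕ) : Hil :=
  if h : (x : ℤ) ≤ n ∧ (y : ℤ) ≤ n then ket ⟨n.toNat, x, y, by omega, by omega⟩ else 0

theorem ketZ_eq {n : ℤ} {x y : ℕ} (p : Idx) (hn : n = p.n) (hx : x = p.x) (hy : y = p.y) :
    ketZ n x y = ket p := by
  subst hn hx hy
  rw [ketZ, dif_pos ⟨by exact_mod_cast p.hx, by exact_mod_cast p.hy⟩]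
  rfl

theorem norm_ketZ_le (n : ℤ) (x y : ℕ) : ‖ketZ n x y‖ ≤ 1 := by
  classical
  rw [ketZ]
  split_ifs
  · rw [ket, lp.norm_single (by norm_num)]
    simp
  · simp

/-- Finitely supported vectors on `ℕ × ℕ × ℤ`. -/
abbrev FinVec : Type := (ℕ × ℕ × ℤ) →₀ ℂ

/-- The inclusion of the finitely supported vectors into the space on which the target acts. -/
def toTarget : FinVec →ₗ[ℂ] TargetModule := Finsupp.linearCombination ℂ targetKet

/-- The embedding of finitely supported vectors into the Hilbert space, translated by `N`. -/
def translate (N : ℕ) : FinVec →ₗ[ℂ] Hil :=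
  Finsupp.linearCombination ℂ fun i : ℕ × ℕ × ℤ => ketZ (N + i.2.2) i.1 i.2.1

theorem eq_zero_of_tendsto_translate {w : FinVec}
    (hw : Tendsto (fun N => translate N w) atTop (𝓝 0)) : w = 0 := by
  classical
  ext ⟨x, y, r⟩
  have hlim : Tendsto (fun N : ℕ => inner ℂ (ketZ (N + r) x y) (translate N w)) atTop (𝓝 0) := by
    refine squeeze_zero_norm (fun N => ?_) (tendsto_zero_iff_norm_tendsto_zero.1 hw)
    refine (norm_inner_le_norm _ _).trans ?_
    exact mul_le_of_le_one_left (norm_nonneg _) (norm_ketZ_le _ _ _)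
  refine tendsto_nhds_unique (tendsto_const_nhds.congr' ?_) hlim
  -- From this threshold on `x ≤ N + r` and `y ≤ N + r`, so the ket exists and the inner product is
  -- exactly the coordinate of `w` at `(x, y, r)`.
  filter_upwards [eventually_ge_atTop (x + y + r.natAbs)] with N hN
  obtain ⟨n, hn⟩ : ∃ n : ℕ, (N : ℤ) + r = n := Int.eq_ofNat_of_zero_le (by omega)
  rw [ketZ_eq ⟨n, x, y, by omega, by omega⟩ hn rfl rfl, inner_ket]
  clear hw hlim
  induction w using Finsupp.induction_linear with
  | zero => simp
  | add v w hv hw =>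
    rw [map_add, Finsupp.add_apply, lp.coeFn_add, Pi.add_apply, hv, hw]
  | single i c =>
    obtain ⟨x', y', r'⟩ := i
    rw [translate, Finsupp.linearCombination_single, lp.coeFn_smul, Pi.smul_apply, ketZ]
    dsimp only
    split_ifs with h
    · rw [ket_apply, Finsupp.single_apply]
      by_cases h' : (x', y', r') = (x, y, r)
      · have h2 := h'
        simp only [Prod.mk.injEq] at h2
        rw [if_pos h', if_pos]
        · simp
        · ext <;> simp <;> omega
      · rw [if_neg h', if_neg]
        · simp
        · intro h2
          simp only [Idx.mk.injEq] at h2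
          refine h' ?_
          simp only [Prod.mk.injEq]
          omega
    · rw [Finsupp.single_apply, if_neg]
      · simp
      · simp only [Prod.mk.injEq]
        omega

/-- On translated finitely supported vectors, the operator `T` is asymptotic to `t`. -/
def AsymptoticTo (T : Hil →L[ℂ] Hil) (t : TargetAlgebra) : Prop :=
  ∀ v : FinVec, ∃ w : FinVec, targetRep t (toTarget v) = toTarget w ∧
    Tendsto (fun N => T (translate N v) - translate N w) atTop (𝓝 0)

theorem AsymptoticTo.add {S T : Hil →L[ℂ] Hil} {s t : TargetAlgebra} (hS : AsymptoticTo S s)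
    (hT : AsymptoticTo T t) : AsymptoticTo (S + T) (s + t) := by
  intro v
  obtain ⟨w, hw, hw'⟩ := hS v
  obtain ⟨z, hz, hz'⟩ := hT v
  refine ⟨w + z, by rw [map_add, LinearMap.add_apply, hw, hz, map_add], ?_⟩
  convert hw'.add hz' using 2 with N
  · rw [map_add, add_apply]
    abel
  · rw [add_zero]

theorem AsymptoticTo.neg {T : Hil →L[ℂ] Hil} {t : TargetAlgebra} (hT : AsymptoticTo T t) :
    AsymptoticTo (-T) (-t) := by
  intro v
  obtain ⟨w, hw, hw'⟩ := hT v
  refine ⟨-w, by rw [map_neg, LinearMap.neg_apply, hw, map_neg], ?_⟩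
  convert hw'.neg using 2 with N
  · rw [map_neg, neg_apply]
    abel
  · rw [neg_zero]

theorem AsymptoticTo.mul {S T : Hil →L[ℂ] Hil} {s t : TargetAlgebra} (hS : AsymptoticTo S s)
    (hT : AsymptoticTo T t) : AsymptoticTo (S * T) (s * t) := by
  intro v
  obtain ⟨w, hw, hw'⟩ := hT v
  obtain ⟨z, hz, hz'⟩ := hS w
  refine ⟨z, by rw [map_mul, Module.End.mul_apply, hw, hz], ?_⟩
  -- The error for the product is `S` applied to the error of `T` on `v`, plus the error of `S` on
  -- `w`.
  have h := ((S.continuous.tendsto 0).comp hw').add hz'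
  rw [map_zero, add_zero] at h
  convert h using 2 with N
  simp only [Function.comp_apply, map_sub, mul_apply_eq_comp]
  abel

theorem asymptoticTo_algebraMap (c : ℂ) :
    AsymptoticTo (algebraMap ℂ _ c) (algebraMap ℂ _ c) := by
  intro v
  refine ⟨c • v, by rw [AlgHom.commutes, map_smul]; rfl, ?_⟩
  refine tendsto_const_nhds.congr fun N => ?_
  rw [map_smul, Algebra.algebraMap_eq_smul_one, smul_apply, one_apply_eq_self, sub_self]

theorem AsymptoticTo.eq_zero {t : TargetAlgebra} (h : AsymptoticTo 0 t) : t = 0 := by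
  refine eq_zero_of_targetRep_eq_zero t fun x y => ?_
  obtain ⟨w, hw, hw'⟩ := h (Finsupp.single (x, y, 0) 1)
  have hw0 : w = 0 := by
    refine eq_zero_of_tendsto_translate ?_
    simpa using hw'.neg
  rwa [hw0, map_zero, toTarget, Finsupp.linearCombination_single, one_smul] at hw

/-- By linearity single basis vectors suffice. There the error is a difference between a coefficient
and its limit, times a ket of norm at most `1`, so pointwise convergence in `(x, y)` is enough. -/
theorem AsymptoticTo.of_ket {T : Hil →L[ℂ] Hil} {t : TargetAlgebra} (s : ℤ) (f g : ℕ → ℕ)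
    (c : ℕ → ℕ → ℕ → ℂ) (l : ℕ → ℕ → ℂ)
    (hT : ∀ x y, ∀ᶠ n : ℕ in atTop, T (ketZ n x y) = c n x y • ketZ (n + s) (f x) (g y))
    (hc : ∀ x y, Tendsto (fun n => c n x y) atTop (𝓝 (l x y)))
    (ht : ∀ x y r, targetRep t (targetKet (x, y, r)) = l x y • targetKet (f x, g y, r + s)) :
    AsymptoticTo T t := by
  intro v
  induction v using Finsupp.induction_linear with
  | zero => exact ⟨0, by simp, by simp⟩
  | add v v' hv hv' =>
    obtain ⟨w, hw, h⟩ := hv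
    obtain ⟨w', hw', h'⟩ := hv'
    refine ⟨w + w', by rw [map_add, map_add, hw, hw', map_add], ?_⟩
    convert h.add h' using 2 with N
    · rw [map_add, map_add, map_add]
      abel
    · rw [add_zero]
  | single i k =>
    obtain ⟨x, y, r⟩ := i
    refine ⟨Finsupp.single (f x, g y, r + s) (k * l x y), ?_, ?_⟩
    · rw [toTarget, Finsupp.linearCombination_single, Finsupp.linearCombination_single, map_smul,
        ht, smul_smul]
    -- The vector with label `r` sits at level `N + r`, so the coefficient sequence is sampled
    -- there; `toNat` is harmless once `N ≥ |r|`.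
    · have hlim : Tendsto (fun N : ℕ => ((N : ℤ) + r).toNat) atTop atTop := by
        refine tendsto_atTop.2 fun b => ?_
        filter_upwards [eventually_ge_atTop (b + r.natAbs)] with N hN
        omega
      have h0 : Tendsto (fun N : ℕ => ‖k * (c ((N : ℤ) + r).toNat x y - l x y)‖) atTop (𝓝 0) := by
        have h := ((((hc x y).comp hlim).sub_const (l x y)).const_mul k).norm
        simpa using h
      refine squeeze_zero_norm' ?_ h0
      filter_upwards [hlim.eventually (hT x y), eventually_ge_atTop r.natAbs] with N hN hr
      have hN' : ((((N : ℤ) + r).toNat : ℕ) : ℤ) = N + r := Int.toNat_of_nonneg (by omega)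
      rw [hN'] at hN
      rw [translate, Finsupp.linearCombination_single, Finsupp.linearCombination_single]
      dsimp only
      rw [map_smul, hN, ← add_assoc, smul_smul, ← sub_smul, ← mul_sub, norm_smul]
      exact mul_le_of_le_one_right (norm_nonneg _) (norm_ketZ_le _ _ _)

theorem AsymptoticTo.of_tmul {T : Hil →L[ℂ] Hil} (κ : ℂ) {a b : SmoothDisk} {m : SmoothCircle}
    {s : ℤ} {f g : ℕ → ℕ} {c : ℕ → ℕ → ℕ → ℂ} {l l' : ℕ → ℂ}
    (ha : ∀ x, (a : Ell2 ℕ →L[ℂ] Ell2 ℕ) (ket x) = l x • ket (f x))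
    (hb : ∀ y, (b : Ell2 ℕ →L[ℂ] Ell2 ℕ) (ket y) = l' y • ket (g y))
    (hm : ∀ z : Circle, (m : C(Circle, ℂ)) z = (z : ℂ) ^ s)
    (hT : ∀ x y, ∀ᶠ n : ℕ in atTop, T (ketZ n x y) = c n x y • ketZ (n + s) (f x) (g y))
    (hc : ∀ x y, Tendsto (fun n => c n x y) atTop (𝓝 (κ * (l x * l' y)))) :
    AsymptoticTo T (κ • (a ⊗ₜ b ⊗ₜ m)) := by
  refine AsymptoticTo.of_ket s f g c _ hT hc fun x y r => ?_
  rw [map_smul, LinearMap.smul_apply, targetKet, targetRep_tmul, ha, hb, TensorProduct.smul_tmul',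
    TensorProduct.tmul_smul, TensorProduct.smul_tmul', smul_smul, TensorProduct.smul_tmul',
    smul_smul, mul_comm (l' y), targetKet]
  have hg : (fun z : Circle => (m : C(Circle, ℂ)) z * (z : ℂ) ^ r) =
      fun z : Circle => (z : ℂ) ^ (r + s) := by
    funext z
    rw [hm, mul_comm, zpow_add₀ (Circle.coe_ne_zero z)]
  rw [hg]
  rfl

/-! ### The action of weighted shifts on kets -/

section WeightedShift

variable {ι : Type} {g : ι → ι} (hg : Function.Injective g) (c : ι → ℂ) (hc : ∀ i, ‖c i‖ ≤ 1)

theorem ofInjective_symm_apply (i : ι) : (ofInjective g hg).symm (g i) = some i := by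
  rw [PEquiv.eq_some_iff]
  rfl

theorem ofInjective_symm_eq_none {j : ι} (hj : ∀ i, g i ≠ j) :
    (ofInjective g hg).symm j = none := by
  cases h : (ofInjective g hg).symm j with
  | none => rfl
  | some i =>
    rw [PEquiv.eq_some_iff] at h
    exact absurd (Option.some_injective _ h) (hj i)

theorem shift_ket (i : ι) : weightedShift (ofInjective g hg) c hc (ket i) = c i • ket (g i) := by
  rw [weightedShift_ket]
  rfl

theorem shift_symm_ket (i : ι) :
    weightedShift (ofInjective g hg).symm c hc (ket (g i)) = c (g i) • ket i := by
  rw [weightedShift_ket, ofInjective_symm_apply]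
  rfl

theorem shift_symm_ket_of_forall_ne {j : ι} (hj : ∀ i, g i ≠ j) :
    weightedShift (ofInjective g hg).symm c hc (ket j) = 0 := by
  rw [weightedShift_ket, ofInjective_symm_eq_none hg hj]
  rfl

theorem star_shift_ket (i : ι) :
    star (weightedShift (ofInjective g hg) c hc) (ket (g i)) = star (c i) • ket i := by
  rw [star_weightedShift_ket, ofInjective_symm_apply]
  rfl

theorem star_shift_ket_of_forall_ne {j : ι} (hj : ∀ i, g i ≠ j) :
    star (weightedShift (ofInjective g hg) c hc) (ket j) = 0 := by
  rw [star_weightedShift_ket, ofInjective_symm_eq_none hg hj]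
  rfl

theorem star_shift_symm_ket (i : ι) :
    star (weightedShift (ofInjective g hg).symm c hc) (ket i) = star (c (g i)) • ket (g i) := by
  rw [star_weightedShift_ket, PEquiv.symm_symm]
  rfl

end WeightedShift

variable (q : Set.Ioo (0 : ℝ) 1)

theorem diskAlpha_ket (x : ℕ) : (diskAlpha q : Ell2 ℕ →L[ℂ] Ell2 ℕ) (ket x) =
    (√(1 - (q : ℝ) ^ (2 * x)) : ℂ) • ket (x - 1) := by
  cases x with
  | zero =>
    refine (shift_symm_ket_of_forall_ne Nat.succ_injective _
      (fun _ => norm_sqrt_le q _) (by simp)).trans ?_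
    simp
  | succ x => exact shift_symm_ket Nat.succ_injective _ (fun _ => norm_sqrt_le q _) x

theorem star_diskAlpha_ket (x : ℕ) :
    ((star (diskAlpha q) : SmoothDisk) : Ell2 ℕ →L[ℂ] Ell2 ℕ) (ket x) =
      (√(1 - (q : ℝ) ^ (2 * (x + 1))) : ℂ) • ket (x + 1) := by
  refine (star_shift_symm_ket Nat.succ_injective _ (fun _ => norm_sqrt_le q _) x).trans ?_
  rw [Complex.star_def, Complex.conj_ofReal]

theorem diskBetaPlus_ket (x : ℕ) : (diskBetaPlus q : Ell2 ℕ →L[ℂ] Ell2 ℕ) (ket x) =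
    (((q : ℝ) ^ x : ℝ) : ℂ) • ket x :=
  weightedShift_ket _ _ (fun x => by
    rw [Complex.norm_real]; exact abs_pow_le_one q x) x

theorem star_diskBetaPlus : star (diskBetaPlus q) = diskBetaPlus q := by
  refine Subtype.ext (ext_ket fun x => ?_)
  refine (star_weightedShift_ket _ _ (fun x => by
    rw [Complex.norm_real]; exact abs_pow_le_one q x) x).trans ?_
  rw [diskBetaPlus_ket]
  change star (((q : ℝ) ^ x : ℝ) : ℂ) • ket x = _
  rw [Complex.star_def, Complex.conj_ofReal]

theorem diskBetaMinus_ket (x : ℕ) : (diskBetaMinus q : Ell2 ℕ →L[ℂ] Ell2 ℕ) (ket x) =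
    ((-(q : ℝ) ^ x : ℝ) : ℂ) • ket x := by
  have h : (diskBetaMinus q : Ell2 ℕ →L[ℂ] Ell2 ℕ) = -diskBetaPlus q := rfl
  rw [h, neg_apply, diskBetaPlus_ket, Complex.ofReal_neg, neg_smul]

theorem star_diskBetaMinus : star (diskBetaMinus q) = diskBetaMinus q := by
  rw [diskBetaMinus, star_neg, star_diskBetaPlus]

theorem circleU_apply (z : Circle) : (circleU : C(Circle, ℂ)) z = (z : ℂ) ^ (1 : ℤ) := by
  rw [zpow_one]
  rfl

theorem star_circleU_apply (z : Circle) :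
    ((star circleU : SmoothCircle) : C(Circle, ℂ)) z = (z : ℂ) ^ (-1 : ℤ) := by
  rw [zpow_neg_one, ← Circle.coe_inv, Circle.coe_inv_eq_conj]
  rfl

/-! ### The action of `α_±`, `β_±` and their adjoints on kets -/

theorem alphaPlus_ketZ {n x y : ℕ} (hx : x ≤ n) (hy : y ≤ n) :
    alphaPlus q (ketZ n x y) = (aPlus q n x y : ℂ) • ketZ (n + 1) x y := by
  rw [ketZ_eq ⟨n, x, y, hx, hy⟩ rfl rfl rfl,
    ketZ_eq (x := x) (y := y) (raise ⟨n, x, y, hx, hy⟩) (by simp [raise])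
      rfl rfl]
  exact shift_ket _ _ _ _

theorem star_alphaPlus_ketZ {n x y : ℕ} (hx : x ≤ n) (hy : y ≤ n) :
    star (alphaPlus q) (ketZ (n + 1) x y) = (aPlus q n x y : ℂ) • ketZ n x y := by
  rw [ketZ_eq ⟨n, x, y, hx, hy⟩ rfl rfl rfl,
    ketZ_eq (x := x) (y := y) (raise ⟨n, x, y, hx, hy⟩) (by simp [raise])
      rfl rfl]
  refine (star_shift_ket _ _ _ _).trans ?_
  rw [Complex.star_def, Complex.conj_ofReal]

theorem alphaMinus_ketZ {n x y : ℕ} (hx : x ≤ n) (hy : y ≤ n) :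
    alphaMinus q (ketZ (n + 1) x y) = (aMinus q (n + 1) x y : ℂ) • ketZ n (x - 1) (y - 1) := by
  rw [ketZ_eq ⟨n + 1, x, y, by omega, by omega⟩ (by simp) rfl rfl,
    ketZ_eq ⟨n, x - 1, y - 1, by omega, by omega⟩ rfl rfl rfl]
  -- On these two faces the index is not in the range of `raiseXY`, and `aMinus` vanishes, so the
  -- truncated `x - 1` and `y - 1` do not matter.
  by_cases h : x = 0 ∨ y = 0
  · refine (shift_symm_ket_of_forall_ne _ _ _ fun p hp => ?_).trans ?_
    · simp only [raiseXY, Idx.mk.injEq] at hp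
      omega
    · rcases h with rfl | rfl <;> simp [aMinus]
  · obtain ⟨x, rfl⟩ := Nat.exists_eq_succ_of_ne_zero (fun h' => h (Or.inl h'))
    obtain ⟨y, rfl⟩ := Nat.exists_eq_succ_of_ne_zero (fun h' => h (Or.inr h'))
    exact shift_symm_ket raiseXY_injective _ _ ⟨n, x, y, by omega, by omega⟩

theorem star_alphaMinus_ketZ {n x y : ℕ} (hx : x ≤ n) (hy : y ≤ n) :
    star (alphaMinus q) (ketZ n x y) =
      (aMinus q (n + 1) (x + 1) (y + 1) : ℂ) • ketZ (n + 1) (x + 1) (y + 1) := by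
  rw [ketZ_eq ⟨n, x, y, hx, hy⟩ rfl rfl rfl,
    ketZ_eq (x := x + 1) (y := y + 1) (raiseXY ⟨n, x, y, hx, hy⟩) (by simp [raiseXY])
      rfl rfl]
  refine (star_shift_symm_ket _ _ _ _).trans ?_
  rw [Complex.star_def, Complex.conj_ofReal]
  rfl

theorem betaPlus_ketZ {n x y : ℕ} (hx : x ≤ n) (hy : y ≤ n) :
    betaPlus q (ketZ n x y) = (bPlus q n x y : ℂ) • ketZ (n + 1) (x + 1) y := by
  rw [ketZ_eq ⟨n, x, y, hx, hy⟩ rfl rfl rfl,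
    ketZ_eq (x := x + 1) (y := y) (raiseX ⟨n, x, y, hx, hy⟩) (by simp [raiseX])
      rfl rfl]
  exact shift_ket _ _ _ _

/-- The case distinction is needed: at `x = 0` the adjoint is zero, but `bPlus` at the truncated `x
- 1 = 0` is not. -/
theorem star_betaPlus_ketZ {n x y : ℕ} (hx : x ≤ n) (hy : y ≤ n) :
    star (betaPlus q) (ketZ (n + 1) x y) =
      ((if x = 0 then 0 else bPlus q n (x - 1) y : ℝ) : ℂ) • ketZ n (x - 1) y := by
  rw [ketZ_eq ⟨n + 1, x, y, by omega, by omega⟩ (by simp) rfl rfl,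
    ketZ_eq ⟨n, x - 1, y, by omega, by omega⟩ rfl rfl rfl]
  cases x with
  | zero =>
    refine (star_shift_ket_of_forall_ne _ _ _ fun p hp => ?_).trans ?_
    · simp only [raiseX, Idx.mk.injEq] at hp
      omega
    · simp
  | succ x =>
    refine (star_shift_ket raiseX_injective _ _ ⟨n, x, y, by omega, by omega⟩).trans ?_
    rw [Complex.star_def, Complex.conj_ofReal, if_neg (Nat.succ_ne_zero x)]
    rfl

theorem betaMinus_ketZ {n x y : ℕ} (hx : x ≤ n) (hy : y ≤ n) :
    betaMinus q (ketZ (n + 1) x y) = (bMinus q (n + 1) x y : ℂ) • ketZ n x (y - 1) := by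
  rw [ketZ_eq ⟨n + 1, x, y, by omega, by omega⟩ (by simp) rfl rfl,
    ketZ_eq ⟨n, x, y - 1, by omega, by omega⟩ rfl rfl rfl]
  cases y with
  | zero =>
    refine (shift_symm_ket_of_forall_ne _ _ _ fun p hp => ?_).trans ?_
    · simp only [raiseY, Idx.mk.injEq] at hp
      omega
    · simp [bMinus]
  | succ y => exact shift_symm_ket raiseY_injective _ _ ⟨n, x, y, by omega, by omega⟩

theorem star_betaMinus_ketZ {n x y : ℕ} (hx : x ≤ n) (hy : y ≤ n) :
    star (betaMinus q) (ketZ n x y) =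
      (bMinus q (n + 1) x (y + 1) : ℂ) • ketZ (n + 1) x (y + 1) := by
  rw [ketZ_eq ⟨n, x, y, hx, hy⟩ rfl rfl rfl,
    ketZ_eq (x := x) (y := y + 1) (raiseY ⟨n, x, y, hx, hy⟩) (by simp [raiseY])
      rfl rfl]
  refine (star_shift_symm_ket _ _ _ _).trans ?_
  rw [Complex.star_def, Complex.conj_ofReal]
  rfl

/-! ### Limits of the coefficients -/

theorem tendsto_sqrt_one_sub_pow {f : ℕ → ℕ} (hf : Tendsto f atTop atTop) :
    Tendsto (fun n => √(1 - (q : ℝ) ^ f n)) atTop (𝓝 1) := by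
  have h := (((tendsto_pow_atTop_nhds_zero_of_lt_one q.2.1.le q.2.2).comp hf).const_sub 1).sqrt
  simpa using h

theorem tendsto_atTop_of_le_add {f : ℕ → ℕ} (k : ℕ) (hf : ∀ n, n ≤ f n + k) :
    Tendsto f atTop atTop := by
  refine tendsto_atTop.2 fun b => ?_
  filter_upwards [eventually_ge_atTop (b + k)] with n hn
  have := hf n
  omega

theorem tendsto_aPlus (x y : ℕ) :
    Tendsto (fun n => aPlus q n x y) atTop (𝓝 ((q : ℝ) ^ (x + y + 1))) := by
  have h := (((tendsto_sqrt_one_sub_pow q (f := fun n => 2 * (n - y) + 2)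
    (tendsto_atTop_of_le_add y (by omega))).mul (tendsto_sqrt_one_sub_pow q
    (f := fun n => 2 * (n - x) + 2) (tendsto_atTop_of_le_add x (by omega)))).div
    ((tendsto_sqrt_one_sub_pow q (f := fun n => 2 * n + 2)
    (tendsto_atTop_of_le_add 0 (by omega))).mul (tendsto_sqrt_one_sub_pow q
    (f := fun n => 2 * n + 4) (tendsto_atTop_of_le_add 0 (by omega)))) (by norm_num)).const_mul
    ((q : ℝ) ^ (x + y + 1))
  simp only [mul_one, div_one] at h
  exact h

theorem tendsto_aMinus (x y : ℕ) : Tendsto (fun n => aMinus q n x y) atTop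
    (𝓝 (√(1 - (q : ℝ) ^ (2 * x)) * √(1 - (q : ℝ) ^ (2 * y)))) := by
  have h := (tendsto_const_nhds (x := √(1 - (q : ℝ) ^ (2 * y)) * √(1 - (q : ℝ) ^ (2 * x)))).div
    ((tendsto_sqrt_one_sub_pow q (f := fun n => 2 * n)
    (tendsto_atTop_of_le_add 0 (by omega))).mul (tendsto_sqrt_one_sub_pow q
    (f := fun n => 2 * n + 2) (tendsto_atTop_of_le_add 0 (by omega)))) (by norm_num)
  rw [mul_comm (√(1 - (q : ℝ) ^ (2 * x)))]
  simp only [mul_one, div_one] at h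
  exact h

theorem tendsto_bPlus (x y : ℕ) : Tendsto (fun n => bPlus q n x y) atTop
    (𝓝 (√(1 - (q : ℝ) ^ (2 * (x + 1))) * -(q : ℝ) ^ y)) := by
  have h := (((tendsto_sqrt_one_sub_pow q (f := fun n => 2 * (n - y) + 2)
    (tendsto_atTop_of_le_add y (by omega))).mul_const (√(1 - (q : ℝ) ^ (2 * x + 2)))).div
    ((tendsto_sqrt_one_sub_pow q (f := fun n => 2 * n + 2)
    (tendsto_atTop_of_le_add 0 (by omega))).mul (tendsto_sqrt_one_sub_pow q
    (f := fun n => 2 * n + 4) (tendsto_atTop_of_le_add 0 (by omega)))) (by norm_num)).const_mul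
    (-(q : ℝ) ^ y)
  rw [mul_comm, mul_add_one]
  simp only [one_mul, mul_one, div_one] at h
  exact h

theorem tendsto_bMinus (x y : ℕ) : Tendsto (fun n => bMinus q n x y) atTop
    (𝓝 ((q : ℝ) ^ x * √(1 - (q : ℝ) ^ (2 * y)))) := by
  have h := (((tendsto_sqrt_one_sub_pow q (f := fun n => 2 * (n - x))
    (tendsto_atTop_of_le_add x (by omega))).const_mul (√(1 - (q : ℝ) ^ (2 * y)))).div
    ((tendsto_sqrt_one_sub_pow q (f := fun n => 2 * n)
    (tendsto_atTop_of_le_add 0 (by omega))).mul (tendsto_sqrt_one_sub_pow q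
    (f := fun n => 2 * n + 2) (tendsto_atTop_of_le_add 0 (by omega)))) (by norm_num)).const_mul
    ((q : ℝ) ^ x)
  simp only [mul_one, div_one] at h
  exact h

theorem tendsto_ofReal {c : ℕ → ℝ} {l : ℝ} {z : ℂ} (h : Tendsto c atTop (𝓝 l)) (hz : l = z) :
    Tendsto (fun n => (c n : ℂ)) atTop (𝓝 z) :=
  hz ▸ (Complex.continuous_ofReal.tendsto l).comp h

/-! ### The symbols of the generators -/

/-- The symbol of `α_+`. -/
def symbolAlphaPlus : TargetAlgebra :=
  (-(q : ℂ)) • (star (diskBetaPlus q) ⊗ₜ[ℂ] diskBetaMinus q ⊗ₜ[ℂ] circleU)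

/-- The symbol of `α_-`. -/
def symbolAlphaMinus : TargetAlgebra := diskAlpha q ⊗ₜ[ℂ] diskAlpha q ⊗ₜ[ℂ] star circleU

/-- The symbol of `β_+`. -/
def symbolBetaPlus : TargetAlgebra := star (diskAlpha q) ⊗ₜ[ℂ] diskBetaMinus q ⊗ₜ[ℂ] circleU

/-- The symbol of `β_-`. -/
def symbolBetaMinus : TargetAlgebra := diskBetaPlus q ⊗ₜ[ℂ] diskAlpha q ⊗ₜ[ℂ] star circleU

/-- Operators that lower the level are described on level `n + 1`. Asymptotically only large levels
matter, so each may be taken to be a successor. -/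
theorem eventually_exists_eq_succ {P : ℕ → Prop} (x y : ℕ)
    (h : ∀ n, x ≤ n → y ≤ n → P (n + 1)) : ∀ᶠ n in atTop, P n := by
  filter_upwards [eventually_gt_atTop (x + y)] with n hn
  obtain ⟨m, rfl⟩ : ∃ m, n = m + 1 := ⟨n - 1, by omega⟩
  exact h m (by omega) (by omega)

/-- The limit `q^(x+y+1)` factors as `(-q) · q^x · (-q^y)`: the sign of the scalar cancels that of
`β` on the second disk. -/
theorem asymptoticTo_alphaPlus : AsymptoticTo (alphaPlus q) (symbolAlphaPlus q) := by
  refine AsymptoticTo.of_tmul (f := id) (g := id) (-(q : ℂ))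
    (by rw [star_diskBetaPlus]; exact diskBetaPlus_ket q) (diskBetaMinus_ket q)
    circleU_apply (c := fun n x y => aPlus q n x y) (fun x y => ?_) fun x y => ?_
  · refine eventually_exists_eq_succ x y fun n hx hy => ?_
    exact alphaPlus_ketZ q (by omega) (by omega)
  · refine tendsto_ofReal (tendsto_aPlus q x y) ?_
    push_cast
    ring

theorem asymptoticTo_star_alphaPlus :
    AsymptoticTo (star (alphaPlus q)) (star (symbolAlphaPlus q)) := by
  rw [symbolAlphaPlus, star_smul, TensorProduct.star_tmul, TensorProduct.star_tmul, star_star]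
  refine AsymptoticTo.of_tmul (f := id) (g := id) (star (-(q : ℂ))) (diskBetaPlus_ket q)
    (by rw [star_diskBetaMinus]; exact diskBetaMinus_ket q)
    -- The adjoint leads from level `n` to `n - 1` and carries the coefficient with which `α_+`
    -- leads back.
    star_circleU_apply (c := fun n x y => aPlus q (n - 1) x y) (fun x y => ?_) fun x y => ?_
  · refine eventually_exists_eq_succ x y fun n hx hy => ?_
    simpa using star_alphaPlus_ketZ q hx hy
  · refine tendsto_ofReal ((tendsto_aPlus q x y).comp (tendsto_sub_atTop_nat 1)) ?_
    rw [star_neg, Complex.star_def, Complex.conj_ofReal]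
    push_cast
    ring

theorem asymptoticTo_alphaMinus : AsymptoticTo (alphaMinus q) (symbolAlphaMinus q) := by
  rw [symbolAlphaMinus, ← one_smul ℂ (_ ⊗ₜ[ℂ] _)]
  refine AsymptoticTo.of_tmul 1 (diskAlpha_ket q) (diskAlpha_ket q)
    star_circleU_apply (c := fun n x y => aMinus q n x y) (fun x y => ?_) fun x y => ?_
  · refine eventually_exists_eq_succ x y fun n hx hy => ?_
    simpa using alphaMinus_ketZ q hx hy
  · refine tendsto_ofReal (tendsto_aMinus q x y) ?_
    push_cast
    ring

theorem asymptoticTo_star_alphaMinus :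
    AsymptoticTo (star (alphaMinus q)) (star (symbolAlphaMinus q)) := by
  rw [symbolAlphaMinus, TensorProduct.star_tmul, TensorProduct.star_tmul, star_star,
    ← one_smul ℂ (_ ⊗ₜ[ℂ] _)]
  refine AsymptoticTo.of_tmul 1 (star_diskAlpha_ket q) (star_diskAlpha_ket q) circleU_apply
    (c := fun n x y => aMinus q (n + 1) (x + 1) (y + 1)) (fun x y => ?_) fun x y => ?_
  · refine eventually_exists_eq_succ x y fun n hx hy => ?_
    exact star_alphaMinus_ketZ q (by omega) (by omega)
  · refine tendsto_ofReal ((tendsto_aMinus q (x + 1) (y + 1)).comp (tendsto_add_atTop_nat 1)) ?_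
    push_cast
    ring

theorem asymptoticTo_betaPlus : AsymptoticTo (betaPlus q) (symbolBetaPlus q) := by
  rw [symbolBetaPlus, ← one_smul ℂ (_ ⊗ₜ[ℂ] _)]
  refine AsymptoticTo.of_tmul (g := id) 1 (star_diskAlpha_ket q) (diskBetaMinus_ket q)
    circleU_apply (c := fun n x y => bPlus q n x y) (fun x y => ?_) fun x y => ?_
  · refine eventually_exists_eq_succ x y fun n hx hy => ?_
    exact betaPlus_ketZ q (by omega) (by omega)
  · refine tendsto_ofReal (tendsto_bPlus q x y) ?_
    push_cast
    ring

theorem asymptoticTo_star_betaPlus :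
    AsymptoticTo (star (betaPlus q)) (star (symbolBetaPlus q)) := by
  rw [symbolBetaPlus, TensorProduct.star_tmul, TensorProduct.star_tmul, star_star,
    ← one_smul ℂ (_ ⊗ₜ[ℂ] _)]
  refine AsymptoticTo.of_tmul (g := id) 1 (diskAlpha_ket q)
    (by rw [star_diskBetaMinus]; exact diskBetaMinus_ket q) star_circleU_apply
    (c := fun n x y => ((if x = 0 then 0 else bPlus q (n - 1) (x - 1) y : ℝ) : ℂ))
    (fun x y => ?_) fun x y => ?_
  · refine eventually_exists_eq_succ x y fun n hx hy => ?_
    simpa using star_betaPlus_ketZ q hx hy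
  -- At `x = 0` both the coefficient and its limit, which contains `√(1 - q^0)`, are zero.
  · cases x with
    | zero => simp
    | succ x =>
      convert tendsto_ofReal ((tendsto_bPlus q x y).comp (tendsto_sub_atTop_nat 1)) rfl using 2
      · simp
      · push_cast
        ring

theorem asymptoticTo_betaMinus : AsymptoticTo (betaMinus q) (symbolBetaMinus q) := by
  rw [symbolBetaMinus, ← one_smul ℂ (_ ⊗ₜ[ℂ] _)]
  refine AsymptoticTo.of_tmul (f := id) 1 (diskBetaPlus_ket q) (diskAlpha_ket q)
    star_circleU_apply (c := fun n x y => bMinus q n x y) (fun x y => ?_) fun x y => ?_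
  · refine eventually_exists_eq_succ x y fun n hx hy => ?_
    simpa using betaMinus_ketZ q hx hy
  · refine tendsto_ofReal (tendsto_bMinus q x y) ?_
    push_cast
    ring

theorem asymptoticTo_star_betaMinus :
    AsymptoticTo (star (betaMinus q)) (star (symbolBetaMinus q)) := by
  rw [symbolBetaMinus, TensorProduct.star_tmul, TensorProduct.star_tmul, star_star,
    ← one_smul ℂ (_ ⊗ₜ[ℂ] _)]
  refine AsymptoticTo.of_tmul (f := id) 1
    (by rw [star_diskBetaPlus]; exact diskBetaPlus_ket q) (star_diskAlpha_ket q) circleU_apply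
    (c := fun n x y => bMinus q (n + 1) x (y + 1)) (fun x y => ?_) fun x y => ?_
  · refine eventually_exists_eq_succ x y fun n hx hy => ?_
    exact star_betaMinus_ketZ q (by omega) (by omega)
  · refine tendsto_ofReal ((tendsto_bMinus q x (y + 1)).comp (tendsto_add_atTop_nat 1)) ?_
    push_cast
    ring

/-! ### The symbol homomorphism -/

/-- `t` is the symbol of `T`: both `T` and its adjoint are asymptotic to `t` and its adjoint. -/
def HasSymbol (T : Hil →L[ℂ] Hil) (t : TargetAlgebra) : Prop :=
  AsymptoticTo T t ∧ AsymptoticTo (star T) (star t)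

theorem HasSymbol.star {T : Hil →L[ℂ] Hil} {t : TargetAlgebra} (h : HasSymbol T t) :
    HasSymbol (star T) (star t) :=
  ⟨h.2, by rw [star_star, star_star]; exact h.1⟩

theorem HasSymbol.add {S T : Hil →L[ℂ] Hil} {s t : TargetAlgebra} (hS : HasSymbol S s)
    (hT : HasSymbol T t) : HasSymbol (S + T) (s + t) :=
  ⟨hS.1.add hT.1, by rw [star_add, star_add]; exact hS.2.add hT.2⟩

theorem HasSymbol.mul {S T : Hil →L[ℂ] Hil} {s t : TargetAlgebra} (hS : HasSymbol S s)
    (hT : HasSymbol T t) : HasSymbol (S * T) (s * t) :=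
  ⟨hS.1.mul hT.1, by rw [star_mul, star_mul]; exact hT.2.mul hS.2⟩

theorem hasSymbol_algebraMap (c : ℂ) : HasSymbol (algebraMap ℂ _ c) (algebraMap ℂ _ c) :=
  ⟨asymptoticTo_algebraMap c, by
    rw [← algebraMap_star_comm, ← algebraMap_star_comm]; exact asymptoticTo_algebraMap _⟩

theorem hasSymbol_alphaPlus : HasSymbol (alphaPlus q) (symbolAlphaPlus q) :=
  ⟨asymptoticTo_alphaPlus q, asymptoticTo_star_alphaPlus q⟩

theorem hasSymbol_alphaMinus : HasSymbol (alphaMinus q) (symbolAlphaMinus q) :=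
  ⟨asymptoticTo_alphaMinus q, asymptoticTo_star_alphaMinus q⟩

theorem hasSymbol_betaPlus : HasSymbol (betaPlus q) (symbolBetaPlus q) :=
  ⟨asymptoticTo_betaPlus q, asymptoticTo_star_betaPlus q⟩

theorem hasSymbol_betaMinus : HasSymbol (betaMinus q) (symbolBetaMinus q) :=
  ⟨asymptoticTo_betaMinus q, asymptoticTo_star_betaMinus q⟩

/-- If `T` is asymptotic to both `s` and `t`, then `0` is asymptotic to `s - t`. This makes the
chosen symbol independent of the choice, and each homomorphism identity follows by exhibiting a
symbol. -/
theorem HasSymbol.unique {T : Hil →L[ℂ] Hil} {s t : TargetAlgebra} (hs : HasSymbol T s)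
    (ht : HasSymbol T t) : s = t := by
  have h := hs.1.add ht.1.neg
  rw [add_neg_cancel] at h
  exact add_neg_eq_zero.1 h.eq_zero

theorem exists_hasSymbol {T : Hil →L[ℂ] Hil} (hT : T ∈ StarAlgebra.adjoin ℂ (generators q)) :
    ∃ t, HasSymbol T t := by
  induction hT using StarAlgebra.adjoin_induction with
  | mem T h =>
    rcases h with rfl | rfl | rfl | rfl
    · exact ⟨_, hasSymbol_alphaPlus q⟩
    · exact ⟨_, hasSymbol_alphaMinus q⟩
    · exact ⟨_, hasSymbol_betaPlus q⟩
    · exact ⟨_, hasSymbol_betaMinus q⟩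
  | algebraMap c => exact ⟨_, hasSymbol_algebraMap c⟩
  | add S T _ _ hS hT => exact ⟨_, hS.choose_spec.add hT.choose_spec⟩
  | mul S T _ _ hS hT => exact ⟨_, hS.choose_spec.mul hT.choose_spec⟩
  | star T _ hT => exact ⟨_, hT.choose_spec.star⟩

theorem exists_hasSymbol_coe (T : pdoAlgebra q) : ∃ t, HasSymbol T t :=
  exists_hasSymbol q (pdoAlgebra_eq_adjoin_generators q ▸ T.2)

/-- The symbol of an element of `ℬ`. -/
def symbol (T : pdoAlgebra q) : TargetAlgebra := (exists_hasSymbol_coe q T).choose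

theorem hasSymbol_symbol (T : pdoAlgebra q) : HasSymbol T (symbol q T) :=
  (exists_hasSymbol_coe q T).choose_spec

theorem symbol_eq {T : pdoAlgebra q} {t : TargetAlgebra} (h : HasSymbol T t) : symbol q T = t :=
  (hasSymbol_symbol q T).unique h

/-- The symbol map as a homomorphism. -/
def symbolHom : pdoAlgebra q →⋆ₐ[ℂ] TargetAlgebra where
  toFun := symbol q
  map_one' := symbol_eq q (by
    have h := hasSymbol_algebraMap 1
    rwa [map_one, map_one] at h)
  map_mul' S T := symbol_eq q ((hasSymbol_symbol q S).mul (hasSymbol_symbol q T))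
  map_zero' := symbol_eq q (by
    have h := hasSymbol_algebraMap 0
    rwa [map_zero, map_zero] at h)
  map_add' S T := symbol_eq q ((hasSymbol_symbol q S).add (hasSymbol_symbol q T))
  commutes' c := symbol_eq q (hasSymbol_algebraMap c)
  map_star' T := symbol_eq q (hasSymbol_symbol q T).star

/-- Keeping the subalgebra as a variable allows its equality with the generated one to be
substituted, so no homomorphism has to be transported. -/
theorem starAlgHom_ext_of_eq_adjoin {A B : Type*} [Semiring A] [StarRing A] [Algebra ℂ A]
    [StarModule ℂ A] [Semiring B] [StarRing B] [Algebra ℂ B] {S : StarSubalgebra ℂ A} {s : Set A}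
    (hS : S = StarAlgebra.adjoin ℂ s) {ρ σ : S →⋆ₐ[ℂ] B}
    (h : ∀ T (hT : T ∈ S), T ∈ s → ρ ⟨T, hT⟩ = σ ⟨T, hT⟩) : ρ = σ := by
  subst hS
  exact StarAlgHom.ext_adjoin fun T hT => h T T.2 hT

end SUq2

end

theorem proposition4 (q : Set.Ioo (0 : ℝ) 1) :
    ∃! ρ : pdoAlgebra q →⋆ₐ[ℂ] SmoothDisk ⊗[ℂ] SmoothDisk ⊗[ℂ] SmoothCircle,
      ρ ⟨alphaPlus q, alphaPlus_mem q⟩ =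
        (-(q : ℂ)) • (star (diskBetaPlus q) ⊗ₜ[ℂ] diskBetaMinus q ⊗ₜ[ℂ] circleU) ∧
      ρ ⟨alphaMinus q, alphaMinus_mem q⟩ =
        diskAlpha q ⊗ₜ[ℂ] diskAlpha q ⊗ₜ[ℂ] star circleU ∧
      ρ ⟨betaPlus q, betaPlus_mem q⟩ =
        star (diskAlpha q) ⊗ₜ[ℂ] diskBetaMinus q ⊗ₜ[ℂ] circleU ∧
      ρ ⟨betaMinus q, betaMinus_mem q⟩ =
        diskBetaPlus q ⊗ₜ[ℂ] diskAlpha q ⊗ₜ[ℂ] star circleU := by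
  have h1 : symbolHom q ⟨alphaPlus q, alphaPlus_mem q⟩ = symbolAlphaPlus q :=
    symbol_eq q (hasSymbol_alphaPlus q)
  have h2 : symbolHom q ⟨alphaMinus q, alphaMinus_mem q⟩ = symbolAlphaMinus q :=
    symbol_eq q (hasSymbol_alphaMinus q)
  have h3 : symbolHom q ⟨betaPlus q, betaPlus_mem q⟩ = symbolBetaPlus q :=
    symbol_eq q (hasSymbol_betaPlus q)
  have h4 : symbolHom q ⟨betaMinus q, betaMinus_mem q⟩ = symbolBetaMinus q :=
    symbol_eq q (hasSymbol_betaMinus q)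
  refine ⟨symbolHom q, ⟨h1, h2, h3, h4⟩, ?_⟩
  rintro ρ ⟨k1, k2, k3, k4⟩
  refine starAlgHom_ext_of_eq_adjoin (pdoAlgebra_eq_adjoin_generators q) ?_
  rintro T hT (rfl | rfl | rfl | rfl)
  · exact k1.trans h1.symm
  · exact k2.trans h2.symm
  · exact k3.trans h3.symm
  · exact k4.trans h4.symm
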